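/- Let $X,Y,Z$ be the Pauli matrices, $H=\frac1{\sqrt2}\begin{pmatrix}1&1\\1&-1\end{pmatrix}$, $T=\mathrm{diag}(1,e^{i\pi/4})$, and let $CNot\,|x,y\rangle=|x,x\oplus y\rangle$. Measuring an observable $O$ with $O^2=1$ means applying one of the projectors $\frac{1\pm O}{2}$ (outcome $\pm1$) with the usual probabilities; $A^{(a)}$ is $A$ acting on qubit $a$. A computation on $n$ logical qubits uses a register of $n+1$ qubits: at each time $n$ of them hold the data and the remaining one is the auxiliary qubit. It uses two kinds of steps, which consist of measurements only. (i) The generalized state transfer of a data qubit $a$, with one-qubit unitaries $U,V$: if $b$ is the auxiliary qubit, measure successively $(VXV^\dagger)^{(b)}$, $(U^\dagger ZU)^{(a)}\otimes(VZV^\dagger)^{(b)}$, $(U^\dagger XU)^{(a)}$; then $b$ holds the data of $a$, and $a$ becomes the auxiliary qubit. (ii) The $CNot$ step on distinct data qubits $a,b$ with auxiliary qubit $c$: measure successively $Z^{(c)}$, $Z^{(a)}\otimes X^{(c)}$, $Z^{(c)}\otimes X^{(b)}$, $X^{(c)}$. An automaton is a finite set of states with a start state, each state being either halting or labelled by one step,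 with a next state for every tuple of outcomes of that step. It simulates an operator $W$ on $n$ qubits if, for every data state $|\varphi\rangle$ and every initial state of the auxiliary qubit, it halts with probability one, and whenever it halts the register is in a product state of the data qubits and the auxiliary qubit, with the data in the state $W|\varphi\rangle$, up to a scalar factor that depends on the outcomes and the initial auxiliary state but not on $|\varphi\rangle$. A set $\mathcal O$ of one- and two-qubit observables suffices to simulate $W$ if some automaton all of whose measurements are of observables in $\mathcal O$ (placed on arbitrary qubits, a two-qubit observable on a pair of qubits in either order) simulates $W$. Then this model is quantum universal: 1. For every $n$, every unitary transformation of $n$ qubits is simulated by some automaton. 2. Each of the two families $\mathcal O_1=\{Z,\,X,\,\frac{1}{\sqrt2}(X+Y),\,Z\otimes Z,\,Z\otimes X\}$ and $\mathcal O_2=\{Z,\,X,\,\frac{1}{\sqrt2}(X+Y),\,Z\otimes X\}$, the second of which has a single two-qubit observable, suffices to simulate every quantum circuit, on any number of qubits, over the gate set $\{H,T,CNot\}$, and every quantum circuit over the gate set $\{H,HT,CNot\}$. 3. Consequently each of $\mathcal O_1,\mathcal O_2$ is universal: for every $n$, every unitary $U$ on $n$ qubits and every $\varepsilon>0$ there is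 a unitary $V$ with $\|V-U\|<\varepsilon$ (operator norm) which the family suffices to simulate. -/

import Mathlib

open scoped Matrix Kronecker Topology

namespace StateTransfer

noncomputable section

/-! ### One- and two-qubit matrices -/

/-- Matrices on one qubit, in the computational basis `|0⟩, |1⟩`. -/
abbrev Mat1 := Matrix (Fin 2) (Fin 2) ℂ

/-- Matrices on two qubits, in the computational basis `|x⟩ ⊗ |y⟩ = |(x, y)⟩`. -/
abbrev Mat2 := Matrix (Fin 2 × Fin 2) (Fin 2 × Fin 2) ℂ

def pauliX : Mat1 := !![0, 1; 1, 0]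

def pauliY : Mat1 := !![0, -Complex.I; Complex.I, 0]

def pauliZ : Mat1 := !![1, 0; 0, -1]

/-- The observable `(X + Y) / √2`. -/
def diagXY : Mat1 := ((Real.sqrt 2 : ℝ) : ℂ)⁻¹ • (pauliX + pauliY)

def gateH : Mat1 := ((Real.sqrt 2 : ℝ) : ℂ)⁻¹ • !![1, 1; 1, -1]

def gateT : Mat1 := !![1, 0; 0, Complex.exp (Complex.I * Real.pi / 4)]

/-- Controlled-not, the first qubit being the control: `|x, y⟩ ↦ |x, x + y⟩`
(addition in `Fin 2` is modulo 2). -/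
def gateCNot : Mat2 :=
  Matrix.of fun p q => if p = (q.1, q.1 + q.2) then 1 else 0

/-- A family of one-qubit matrices and two-qubit matrices: a family of observables, or a set of
gates. -/
structure Family where
  one : Set Mat1
  two : Set Mat2

/-- The observables `Z, X, (X+Y)/√2, Z ⊗ Z, Z ⊗ X`. -/
def obsFamily₁ : Family where
  one := {pauliZ, pauliX, diagXY}
  two := {pauliZ ⊗ₖ pauliZ, pauliZ ⊗ₖ pauliX}

/-- The observables `Z, X, (X+Y)/√2, Z ⊗ X`. -/
def obsFamily₂ : Family where
  one := {pauliZ, pauliX, diagXY}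
  two := {pauliZ ⊗ₖ pauliX}

/-- No restriction on the observables. -/
def allObs : Family where
  one := Set.univ
  two := Set.univ

/-- The gate set `H, T, CNot`. -/
def gatesHT : Family where
  one := {gateH, gateT}
  two := {gateCNot}

/-- The gate set `H, HT, CNot`. -/
def gatesHHT : Family where
  one := {gateH, gateH * gateT}
  two := {gateCNot}

/-! ### Registers -/

/-- (Unnormalised) pure states of a register whose qubits are labelled by `W`. -/
abbrev Ket (W : Type) := (W → Fin 2) → ℂ

/-- Operators on a register whose qubits are labelled by `W`. -/
abbrev Op (W : Type) := Matrix (W → Fin 2) (W → Fin 2) ℂ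

/-- The squared norm of a state. For the unnormalised state left by a sequence of measurement
outcomes on a unit vector, it is the probability of these outcomes. -/
def weight {W : Type} [Fintype W] [DecidableEq W] (ψ : Ket W) : ℝ := ∑ x, Complex.normSq (ψ x)

/-- A one-qubit matrix at a qubit, or a two-qubit matrix at an ordered pair of distinct qubits. -/
inductive LocalOp (W : Type) where
  | one (a : W) (M : Mat1)
  | two (a b : W) (hab : a ≠ b) (M : Mat2)

/-- The operator on the whole register: the given matrix on the named qubits, tensored with the
identity on all the others. -/
def LocalOp.toOp {W : Type} [Fintype W] [DecidableEq W] : LocalOp W → Op W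
  | .one a M => Matrix.of fun x y =>
      if ∀ w, w ≠ a → x w = y w then M (x a) (y a) else 0
  | .two a b _ M => Matrix.of fun x y =>
      if ∀ w, w ≠ a → w ≠ b → x w = y w then M (x a, x b) (y a, y b) else 0

/-- The local matrix belongs to the family. A two-qubit element `M` may be used on the pair of
qubits in either order, so that `X^(a) ⊗ Z^(b)` is an instance of `Z ⊗ X`. -/
def LocalOp.MemFamily {W : Type} (F : Family) : LocalOp W → Prop
  | .one _ M => M ∈ F.one
  | .two _ _ _ M => M ∈ F.two ∨ M.submatrix Prod.swap Prod.swap ∈ F.two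

/-- The projector for outcome `1` (`s = true`) or `-1` (`s = false`) of the measurement of an
observable `M` with `M² = 1`. -/
def proj {W : Type} [Fintype W] [DecidableEq W] (M : Op W) (s : Bool) : Op W :=
  (2 : ℂ)⁻¹ • (1 + (if s then (1 : ℂ) else -1) • M)

/-! ### Quantum circuits -/

/-- Circuits on `n` qubits: sequences of gates, the head of the list being applied first. -/
abbrev Circuit (n : ℕ) := List (LocalOp (Fin n))

/-- All gates of the circuit belong to the gate set `G`. -/
def Circuit.Over {n : ℕ} (c : Circuit n) (G : Family) : Prop := ∀ g ∈ c, g.MemFamily G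

/-- The operator computed by a circuit. -/
def Circuit.toOp {n : ℕ} (c : Circuit n) : Op (Fin n) :=
  (c.map LocalOp.toOp).reverse.prod

/-! ### Steps of simulation with one auxiliary qubit

The physical register of a computation on `n` qubits has `n + 1` qubits, labelled by
`Option (Fin n)`. As a state transfer moves the state of a qubit to another qubit, the place of the
data in the register changes during the computation. -/

/-- Where the data are: `e (some i)` is the physical qubit that holds the `i`-th logical qubit, and
`e none` is the physical qubit that is currently the auxiliary one. -/
abbrev Placement (n : ℕ) := Equiv.Perm (Option (Fin n))

/-- The physical state in which the logical qubits, placed according to `e`, are in the state `φ`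
and the auxiliary qubit is in the state `χ`: the product state `φ ⊗ χ`. -/
def join {n : ℕ} (e : Placement n) (φ : Ket (Fin n)) (χ : Fin 2 → ℂ) : Ket (Option (Fin n)) :=
  fun x => φ (fun i => x (e (some i))) * χ (x (e none))

/-- Steps of simulation: the generalised state transfer of the `i`-th logical qubit, with unitary
matrices `U` (before the transfer) and `V` (after it), and the step for `CNot` with control `i`
and target `j`. -/
inductive Step (n : ℕ) where
  | transfer (i : Fin n) (U V : Matrix.unitaryGroup (Fin 2) ℂ)
  | cnot (i j : Fin n) (hij : i ≠ j)

/-- The number of measurements of a step. -/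
def Step.arity {n : ℕ} : Step n → ℕ
  | .transfer _ _ _ => 3
  | .cnot _ _ _ => 4

/-- The observables measured during a step, in this order.

For a generalised state transfer from the data qubit `a` to the auxiliary qubit `b`:
`(V X V†)^(b)`, `(U† Z U)^(a) ⊗ (V Z V†)^(b)`, `(U† X U)^(a)`; the case `U = V = 1` is the plain
state transfer `X^(b)`, `Z^(a) ⊗ Z^(b)`, `X^(a)`.

For `CNot` with control `a`, target `b` and auxiliary qubit `c`:
`Z^(c)`, `Z^(a) ⊗ X^(c)`, `Z^(c) ⊗ X^(b)`, `X^(c)`. -/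
def Step.obs {n : ℕ} (e : Placement n) : (s : Step n) → Fin s.arity → LocalOp (Option (Fin n))
  | .transfer i U V =>
      ![.one (e none) (V.1 * pauliX * V.1ᴴ),
        .two (e (some i)) (e none) (fun h => Option.some_ne_none i (e.injective h))
          ((U.1ᴴ * pauliZ * U.1) ⊗ₖ (V.1 * pauliZ * V.1ᴴ)),
        .one (e (some i)) (U.1ᴴ * pauliX * U.1)]
  | .cnot i j _ =>
      ![.one (e none) pauliZ,
        .two (e (some i)) (e none) (fun h => Option.some_ne_none i (e.injective h))
          (pauliZ ⊗ₖ pauliX),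
        .two (e none) (e (some j)) (fun h => Option.some_ne_none j (e.injective h).symm)
          (pauliZ ⊗ₖ pauliX),
        .one (e none) pauliX]

/-- The placement of the data after a step: a state transfer exchanges the roles of the data qubit
and of the auxiliary qubit. -/
def Step.move {n : ℕ} (e : Placement n) : Step n → Placement n
  | .transfer i _ _ => (Equiv.swap (some i) none).trans e
  | .cnot _ _ _ => e

/-- The operator by which a step acts on the physical register when the outcomes of its
measurements are `o`: the product of the corresponding projectors, the first measurement being the
rightmost factor. -/
def Step.kraus {n : ℕ} (e : Placement n) (s : Step n) (o : Fin s.arity → Bool) :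
    Op (Option (Fin n)) :=
  (List.ofFn fun k => proj (s.obs e k).toOp (o k)).reverse.prod

/-! ### Automata -/

/-- A finite automaton each of whose states encapsulates a step of simulation, with a transition
for each tuple of classical outcomes, or is a halting state (`action q = none`). -/
structure Automaton (n : ℕ) where
  State : Type
  finite : Finite State
  start : State
  action : State → Option (Σ s : Step n, (Fin s.arity → Bool) → State)

namespace Automaton

variable {n : ℕ}

/-- All measurements performed by the automaton are of observables of the family `O`. -/
def UsesOnly (A : Automaton n) (O : Family) : Prop :=
  ∀ (q : A.State) (s : Step n) (next : (Fin s.arity → Bool) → A.State),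
    A.action q = some ⟨s, next⟩ → ∀ (e : Placement n) (k : Fin s.arity), (s.obs e k).MemFamily O

/-- `A.Branch q e K`: for some sequence of outcomes, the automaton goes from its start state, with
the `i`-th logical qubit in the `i`-th physical qubit, to the state `q` with placement `e` of the
data, and acts by the operator `K` on the physical register. -/
inductive Branch (A : Automaton n) : A.State → Placement n → Op (Option (Fin n)) → Prop
  | init : Branch A A.start (Equiv.refl _) 1
  | step {q : A.State} {e : Placement n} {K : Op (Option (Fin n))} {s : Step n}
      {next : (Fin s.arity → Bool) → A.State} (o : Fin s.arity → Bool) :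
      Branch A q e K → A.action q = some ⟨s, next⟩ →
      Branch A (next o) (s.move e) (s.kraus e o * K)

/-- The probability, multiplied by `weight ψ`, that the automaton started in the state `q` with
placement `e` and physical state `ψ` halts after at most `N` steps. -/
def haltWeight (A : Automaton n) :
    ℕ → A.State → Placement n → Ket (Option (Fin n)) → ℝ
  | 0, q, _, ψ =>
      match A.action q with
      | none => weight ψ
      | some _ => 0
  | N + 1, q, e, ψ =>
      match A.action q with
      | none => weight ψ
      | some ⟨s, next⟩ => ∑ o, haltWeight A N (next o) (s.move e) (s.kraus e o *ᵥ ψ)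

/-- The automaton simulates `U`, on every state `φ` of the data and every initial state `χ` of the
auxiliary qubit: it halts with probability one, and whenever it halts, the data are in the state
`U φ`. (The scalar by which a sequence of outcomes multiplies the data, made of a global phase and
of the square root of a probability, is part of `χ'`; it does not depend on `φ`.) -/
def Simulates (A : Automaton n) (U : Op (Fin n)) : Prop :=
  (∀ (φ : Ket (Fin n)) (χ : Fin 2 → ℂ),
    Filter.Tendsto (fun N => A.haltWeight N A.start (Equiv.refl _) (join (Equiv.refl _) φ χ))
      Filter.atTop (𝓝 (weight (join (Equiv.refl _) φ χ)))) ∧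
  ∀ (q : A.State) (e : Placement n) (K : Op (Option (Fin n))),
    A.Branch q e K → A.action q = none →
      ∀ χ : Fin 2 → ℂ, ∃ χ' : Fin 2 → ℂ, ∀ φ : Ket (Fin n),
        K *ᵥ join (Equiv.refl _) φ χ = join e (U *ᵥ φ) χ'

end Automaton

/-- Some automaton made of steps of simulation, with a single auxiliary qubit, and measuring only
observables of the family `O`, simulates `U`. -/
def Simulable (O : Family) {n : ℕ} (U : Op (Fin n)) : Prop :=
  ∃ A : Automaton n, A.UsesOnly O ∧ A.Simulates U

/-- Every circuit over the gate set `G`, on any number of qubits, is simulated with observables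
of `O`. -/
def SimulatesCircuits (O G : Family) : Prop :=
  ∀ (n : ℕ) (c : Circuit n), c.Over G → Simulable O c.toOp

/-- Every unitary transformation, on any number of qubits, is simulated with observables of `O`. -/
def ExactlyUniversal (O : Family) : Prop :=
  ∀ (n : ℕ) (U : Op (Fin n)), U ∈ Matrix.unitaryGroup (Fin n → Fin 2) ℂ → Simulable O U

open scoped Matrix.Norms.L2Operator in
/-- Every unitary transformation, on any number of qubits, is approximated to any precision, in
operator norm, by unitary transformations that are simulated with observables of `O`. -/
def Universal (O : Family) : Prop :=
  ∀ (n : ℕ) (U : Op (Fin n)), U ∈ Matrix.unitaryGroup (Fin n → Fin 2) ℂ →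
    ∀ ε : ℝ, 0 < ε → ∃ V ∈ Matrix.unitaryGroup (Fin n → Fin 2) ℂ, ‖V - U‖ < ε ∧ Simulable O V

end

end StateTransfer

/-
A generalized state transfer acts on the data as `V P U`, where `P` is a Pauli operator determined
by the outcomes. Repeating transfers makes the error walk at random on the Pauli group modulo
phases; every Pauli error occurs with probability 1/4, whatever the data, so that with probability
one the walk reaches the wanted operator. Hence exact Pauli operators are simulated, and with them
the errors of the transfers and of the controlled-not are corrected. A unitary group generated by
one-qubit unitaries and controlled-nots contains all diagonal operators, since these are products of
parity-dependent phases, and all reflections, since any vector can be moved to a basis vector qubit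
by qubit; so it is the whole unitary group. For the finite gate sets, a word in `H` and `T` is a
rotation by an angle that is not a rational multiple of `π`, so that the group generated by these
gates is dense.
-/

open scoped Matrix Kronecker Topology

namespace StateTransfer

noncomputable section

/-! ### Operators on one or two qubits of a register -/

theorem bit_add_self_add (s t : Fin 2) : s + (s + t) = t := by
  decide +revert

section LocalOperators

variable {W : Type} [Fintype W] [DecidableEq W]

theorem LocalOp.toOp_one_mulVec (a : W) (M : Mat1) (ψ : Ket W) (x : W → Fin 2) :
    ((LocalOp.one a M).toOp *ᵥ ψ) x = ∑ t, M (x a) t * ψ (Function.update x a t) := by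
  simp only [LocalOp.toOp, Matrix.mulVec, dotProduct, Matrix.of_apply]
  symm
  refine Finset.sum_of_injOn (fun t => Function.update x a t) ?_ (by simp) ?_ ?_
  · exact (Function.update_injective x a).injOn
  · intro y _ hy
    rw [if_neg, zero_mul]
    refine fun h => hy ⟨y a, by simp, ?_⟩
    exact Function.update_eq_iff.2 ⟨rfl, fun w hw => h w hw⟩
  · intro t _
    rw [if_pos fun w hw => (Function.update_of_ne hw _ _).symm, Function.update_self]

theorem LocalOp.toOp_two_mulVec (a b : W) (hab : a ≠ b) (M : Mat2) (ψ : Ket W) (x : W → Fin 2) :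
    ((LocalOp.two a b hab M).toOp *ᵥ ψ) x =
      ∑ p, M (x a, x b) p * ψ (Function.update (Function.update x a p.1) b p.2) := by
  simp only [LocalOp.toOp, Matrix.mulVec, dotProduct, Matrix.of_apply]
  symm
  refine Finset.sum_of_injOn (fun p => Function.update (Function.update x a p.1) b p.2)
    ?_ (by simp) ?_ ?_
  · intro s _ t _ h
    have h_fst : s.1 = t.1 := by simpa [hab] using congrFun h a
    have h_snd : s.2 = t.2 := by simpa using congrFun h b
    exact Prod.ext h_fst h_snd
  · intro y _ hy
    rw [if_neg, zero_mul]
    refine fun h => hy ⟨(y a, y b), by simp, ?_⟩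
    refine Function.update_eq_iff.2 ⟨rfl, fun w hwb => ?_⟩
    rcases eq_or_ne w a with rfl | hwa
    · simp
    · simp [hwa, h w hwa hwb]
  · intro p _
    rw [if_pos]
    · simp [hab]
    · intro w hwa hwb
      simp [hwa, hwb]

/-- A one-qubit matrix placed on the qubit `a` of a register, as a homomorphism of star
algebras. -/
def onQubit (a : W) : Mat1 →⋆ₐ[ℂ] Op W where
  toAlgHom := AlgHom.ofLinearMap
    { toFun := fun M => (LocalOp.one a M).toOp
      map_add' := fun M N => by
        ext x y
        simp only [LocalOp.toOp, Matrix.of_apply, Matrix.add_apply]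
        split_ifs <;> simp
      map_smul' := fun c M => by
        ext x y
        simp only [LocalOp.toOp, Matrix.of_apply, Matrix.smul_apply, RingHom.id_apply]
        split_ifs <;> simp }
    (Matrix.ext_iff_mulVec.2 fun ψ => funext fun x => by
      simp [LocalOp.toOp_one_mulVec, Matrix.one_apply])
    (fun M N => Matrix.ext_iff_mulVec.2 fun ψ => funext fun x => by
      simp only [LinearMap.coe_mk, AddHom.coe_mk, ← Matrix.mulVec_mulVec,
        LocalOp.toOp_one_mulVec, Matrix.mul_apply, Fin.sum_univ_two, Function.update_self,
        Function.update_idem]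
      ring)
  map_star' M := by
    ext x y
    change (LocalOp.one a (star M)).toOp x y = star (LocalOp.one a M).toOp x y
    simp only [LocalOp.toOp, Matrix.star_apply, Matrix.of_apply, eq_comm, apply_ite star,
      star_zero]

theorem toOp_one (a : W) (M : Mat1) : (LocalOp.one a M).toOp = onQubit a M := rfl

theorem onQubit_mulVec (a : W) (M : Mat1) (ψ : Ket W) (x : W → Fin 2) :
    (onQubit a M *ᵥ ψ) x = ∑ t, M (x a) t * ψ (Function.update x a t) :=
  LocalOp.toOp_one_mulVec a M ψ x

theorem onQubit_commute {a b : W} (hab : a ≠ b) (M N : Mat1) :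
    Commute (onQubit a M) (onQubit b N) := by
  refine Matrix.ext_iff_mulVec.2 fun ψ => funext fun x => ?_
  simp only [← Matrix.mulVec_mulVec, onQubit_mulVec, Fin.sum_univ_two,
    Function.update_of_ne hab, Function.update_of_ne hab.symm, Function.update_comm hab]
  ring

theorem onQubit_mem_unitary (a : W) {M : Mat1} (hM : M ∈ Matrix.unitaryGroup (Fin 2) ℂ) :
    onQubit a M ∈ Matrix.unitaryGroup (W → Fin 2) ℂ :=
  Unitary.map_mem (onQubit a) hM

theorem continuous_onQubit (a : W) : Continuous (onQubit a : Mat1 → Op W) :=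
  LinearMap.continuous_of_finiteDimensional (onQubit a).toAlgHom.toLinearMap

theorem onQubit_diagonal (a : W) (d : Fin 2 → ℂ) :
    onQubit a (Matrix.diagonal d) = Matrix.diagonal fun x => d (x a) := by
  refine Matrix.ext_iff_mulVec.2 fun ψ => funext fun x => ?_
  rw [onQubit_mulVec,
    Finset.sum_eq_single (x a) (by simp +contextual [eq_comm (b := x a)]) (by simp)]
  simp [Matrix.mulVec_diagonal]

theorem toOp_two_kronecker {a b : W} (hab : a ≠ b) (M N : Mat1) :
    (LocalOp.two a b hab (M ⊗ₖ N)).toOp = onQubit a M * onQubit b N := by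
  refine Matrix.ext_iff_mulVec.2 fun ψ => funext fun x => ?_
  simp only [← Matrix.mulVec_mulVec, onQubit_mulVec, LocalOp.toOp_two_mulVec, Fin.sum_univ_two,
    Fintype.sum_prod_type, Matrix.kroneckerMap_apply, Function.update_of_ne hab.symm]
  ring

theorem toOp_two_swap {a b : W} (hab : a ≠ b) (M : Mat2) :
    (LocalOp.two a b hab M).toOp =
      (LocalOp.two b a hab.symm (M.submatrix Prod.swap Prod.swap)).toOp := by
  refine Matrix.ext_iff_mulVec.2 fun ψ => funext fun x => ?_
  simp only [LocalOp.toOp_two_mulVec, Fin.sum_univ_two, Fintype.sum_prod_type,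
    Matrix.submatrix_apply, Prod.swap_prod_mk, Function.update_comm hab]
  ring

/-- The controlled-not with control `a` and target `b` on a register. -/
def cnotOp {a b : W} (hab : a ≠ b) : Op W := (LocalOp.two a b hab gateCNot).toOp

theorem cnotOp_mulVec {a b : W} (hab : a ≠ b) (ψ : Ket W) (x : W → Fin 2) :
    (cnotOp hab *ᵥ ψ) x = ψ (Function.update x b (x a + x b)) := by
  have gateCNot_apply (s t : Fin 2) (q : Fin 2 × Fin 2) :
      gateCNot (s, t) q = if q = (s, s + t) then 1 else 0 := by
    have : (s, t) = (q.1, q.1 + q.2) ↔ q = (s, s + t) := by decide +revert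
    simp only [gateCNot, Matrix.of_apply, this]
  simp [cnotOp, LocalOp.toOp_two_mulVec, gateCNot_apply]

theorem cnotOp_mul_self {a b : W} (hab : a ≠ b) : cnotOp hab * cnotOp hab = 1 := by
  refine Matrix.ext_iff_mulVec.2 fun ψ => funext fun x => ?_
  simp [← Matrix.mulVec_mulVec, cnotOp_mulVec, Function.update_of_ne hab, bit_add_self_add]

theorem cnotOp_conjTranspose {a b : W} (hab : a ≠ b) : (cnotOp hab)ᴴ = cnotOp hab := by
  ext x y
  have bits_iff : (y a, y b) = (x a, x a + x b) ↔ (x a, x b) = (y a, y a + y b) := by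
    generalize x a = s, x b = t, y a = u, y b = v
    decide +revert
  simp only [cnotOp, LocalOp.toOp, gateCNot, Matrix.conjTranspose_apply, Matrix.of_apply,
    bits_iff, apply_ite star, star_zero, star_one, eq_comm (a := y _) (b := x _)]

theorem cnotOp_mem_unitary {a b : W} (hab : a ≠ b) :
    cnotOp hab ∈ Matrix.unitaryGroup (W → Fin 2) ℂ := by
  rw [Matrix.mem_unitaryGroup_iff, Matrix.star_eq_conjTranspose, cnotOp_conjTranspose,
    cnotOp_mul_self]

theorem cnotOp_mul_diagonal_mul_cnotOp {a b : W} (hab : a ≠ b) (d : (W → Fin 2) → ℂ) :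
    cnotOp hab * Matrix.diagonal d * cnotOp hab =
      Matrix.diagonal fun x => d (Function.update x b (x a + x b)) := by
  refine Matrix.ext_iff_mulVec.2 fun ψ => funext fun x => ?_
  simp [← Matrix.mulVec_mulVec, cnotOp_mulVec, Matrix.mulVec_diagonal, Function.update_of_ne hab,
    bit_add_self_add]

end LocalOperators

/-! ### Observables -/

section Observables

/-- Observables with the values `±1`: self-adjoint elements that square to one. -/
structure IsObservable {R : Type*} [Mul R] [One R] [Star R] (A : R) : Prop where
  isSelfAdjoint : IsSelfAdjoint A
  mul_self : A * A = 1

/-- Elements `A`, `B` such that `A B = -B A`. The two outcomes of a measurement of `B` right after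
one of `A` are then equally likely. -/
def Anticommute {R : Type*} [Mul R] [Neg R] (A B : R) : Prop := A * B = -(B * A)

theorem IsObservable.map {R S F : Type*} [Monoid R] [Star R] [Monoid S] [Star S] [FunLike F R S]
    [MonoidHomClass F R S] [StarHomClass F R S] {A : R} (hA : IsObservable A) (f : F) :
    IsObservable (f A) :=
  ⟨hA.isSelfAdjoint.map f, by rw [← map_mul, hA.mul_self, map_one]⟩

theorem IsObservable.mul {R : Type*} [Monoid R] [StarMul R] {A B : R} (hA : IsObservable A)
    (hB : IsObservable B) (hAB : Commute A B) : IsObservable (A * B) :=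
  ⟨(hA.isSelfAdjoint.commute_iff hB.isSelfAdjoint).1 hAB,
    by rw [hAB.symm.mul_mul_mul_comm, hA.mul_self, hB.mul_self, one_mul]⟩

theorem Anticommute.map {R S F : Type*} [NonUnitalNonAssocRing R] [NonUnitalNonAssocRing S]
    [FunLike F R S] [NonUnitalRingHomClass F R S] {A B : R} (h : Anticommute A B) (f : F) :
    Anticommute (f A) (f B) := by
  rw [Anticommute, ← map_mul, ← map_mul, ← map_neg, h]

theorem Anticommute.mul_right {R : Type*} [NonUnitalRing R] {A B C : R} (hCB : Anticommute C B)
    (hAC : Commute A C) : Anticommute C (A * B) := by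
  rw [Anticommute, ← mul_assoc, ← hAC.eq, mul_assoc, hCB, mul_neg, mul_assoc]

theorem Anticommute.mul_left {R : Type*} [NonUnitalRing R] {A B C : R} (hAC : Anticommute A C)
    (hBC : Commute B C) : Anticommute (A * B) C := by
  rw [Anticommute, mul_assoc, hBC.eq, ← mul_assoc, hAC, neg_mul, mul_assoc]

variable {ι : Type*} [Fintype ι] [DecidableEq ι]

theorem IsObservable.unitary_conj {M : Matrix ι ι ℂ} (hM : IsObservable M)
    (V : Matrix.unitaryGroup ι ℂ) : IsObservable (V.1 * M * V.1ᴴ) :=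
  hM.map (Unitary.conjStarAlgAut ℂ _ V)

theorem IsObservable.unitary_conj_symm {M : Matrix ι ι ℂ} (hM : IsObservable M)
    (U : Matrix.unitaryGroup ι ℂ) : IsObservable (U.1ᴴ * M * U.1) :=
  hM.map (Unitary.conjStarAlgAut ℂ _ U).symm

theorem Anticommute.unitary_conj {M N : Matrix ι ι ℂ} (h : Anticommute M N)
    (V : Matrix.unitaryGroup ι ℂ) : Anticommute (V.1 * M * V.1ᴴ) (V.1 * N * V.1ᴴ) :=
  h.map (Unitary.conjStarAlgAut ℂ _ V)

theorem Anticommute.unitary_conj_symm {M N : Matrix ι ι ℂ} (h : Anticommute M N)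
    (U : Matrix.unitaryGroup ι ℂ) : Anticommute (U.1ᴴ * M * U.1) (U.1ᴴ * N * U.1) :=
  h.map (Unitary.conjStarAlgAut ℂ _ U).symm

end Observables

/-! ### Pauli matrices -/

theorem isObservable_pauliX : IsObservable pauliX where
  isSelfAdjoint := by
    ext i j
    fin_cases i <;> fin_cases j <;> simp [pauliX]
  mul_self := by simp [pauliX, Matrix.one_fin_two]

theorem isObservable_pauliZ : IsObservable pauliZ where
  isSelfAdjoint := by
    ext i j
    fin_cases i <;> fin_cases j <;> simp [pauliZ]
  mul_self := by simp [pauliZ, Matrix.one_fin_two]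

theorem anticommute_pauliX_pauliZ : Anticommute pauliX pauliZ := by
  simp [Anticommute, pauliX, pauliZ]

theorem anticommute_pauliZ_pauliX : Anticommute pauliZ pauliX := by
  simp [Anticommute, pauliX, pauliZ]

/-! ### Measurements and their weights -/

section Measurements

variable {W : Type} [Fintype W] [DecidableEq W]

theorem IsObservable.toOp_two_kronecker {a b : W} (hab : a ≠ b) {M N : Mat1}
    (hM : IsObservable M) (hN : IsObservable N) :
    IsObservable (LocalOp.two a b hab (M ⊗ₖ N)).toOp := by
  rw [StateTransfer.toOp_two_kronecker]
  exact (hM.map (onQubit a)).mul (hN.map (onQubit b)) (onQubit_commute hab M N)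

/-- The sign of a measurement outcome. -/
def outcomeSign (s : Bool) : ℂ := if s then 1 else -1

theorem star_outcomeSign (s : Bool) : star (outcomeSign s) = outcomeSign s := by
  cases s <;> simp [outcomeSign]

theorem outcomeSign_mul_self (s : Bool) : outcomeSign s * outcomeSign s = 1 := by
  cases s <;> simp [outcomeSign]

theorem proj_eq (M : Op W) (s : Bool) : proj M s = (2 : ℂ)⁻¹ • (1 + outcomeSign s • M) := rfl

theorem IsObservable.isStarProjection_proj {M : Op W} (hM : IsObservable M) (s : Bool) :
    IsStarProjection (proj M s) where
  isIdempotentElem := by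
    simp only [IsIdempotentElem, proj_eq, smul_mul_assoc, mul_smul_comm, add_mul, mul_add,
      one_mul, mul_one, hM.mul_self, smul_smul, smul_add]
    match_scalars
    · linear_combination 4⁻¹ * outcomeSign_mul_self s
    · ring
  isSelfAdjoint := by
    simp [IsSelfAdjoint, proj_eq, star_smul, hM.isSelfAdjoint.star_eq, star_outcomeSign]

theorem proj_true_add_proj_false (M : Op W) : proj M true + proj M false = 1 := by
  simp only [proj_eq, outcomeSign, if_true, Bool.false_eq_true, if_false]
  module

theorem Anticommute.proj_mul_mul_proj {A B : Op W} (hAB : Anticommute A B) (hA : IsObservable A)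
    (s : Bool) : proj A s * (B * proj A s) = 0 := by
  have hAB_eq : A * B = -(B * A) := hAB
  simp only [proj_eq, smul_mul_assoc, mul_smul_comm, add_mul, mul_add, one_mul, mul_one,
    ← mul_assoc, hAB_eq]
  simp only [neg_mul, mul_assoc, hA.mul_self, mul_one, smul_neg, smul_add, smul_smul]
  match_scalars
  · linear_combination -4⁻¹ * outcomeSign_mul_self s
  · ring

theorem Anticommute.proj_mul_proj_mul_proj {A B : Op W} (hAB : Anticommute A B)
    (hA : IsObservable A) (s t : Bool) :
    proj A s * (proj B t * proj A s) = (2 : ℂ)⁻¹ • proj A s := by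
  rw [proj_eq B, smul_mul_assoc, mul_smul_comm, add_mul, mul_add, smul_mul_assoc, mul_smul_comm,
    hAB.proj_mul_mul_proj hA, one_mul, (hA.isStarProjection_proj s).isIdempotentElem.eq, smul_zero,
    add_zero]

theorem weight_nonneg (ψ : Ket W) : 0 ≤ weight ψ :=
  Finset.sum_nonneg fun _ _ => Complex.normSq_nonneg _

theorem weight_eq_dotProduct (ψ : Ket W) : (weight ψ : ℂ) = star ψ ⬝ᵥ ψ := by
  simp [weight, dotProduct, Complex.normSq_eq_conj_mul_self]

theorem weight_mulVec (M : Op W) (ψ : Ket W) :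
    (weight (M *ᵥ ψ) : ℂ) = star ψ ⬝ᵥ ((star M * M) *ᵥ ψ) := by
  rw [weight_eq_dotProduct, Matrix.star_mulVec, ← Matrix.dotProduct_mulVec, Matrix.mulVec_mulVec,
    Matrix.star_eq_conjTranspose]

theorem weight_mulVec_of_isStarProjection {P : Op W} (hP : IsStarProjection P) (ψ : Ket W) :
    (weight (P *ᵥ ψ) : ℂ) = star ψ ⬝ᵥ (P *ᵥ ψ) := by
  rw [weight_mulVec, hP.isSelfAdjoint.star_eq, hP.isIdempotentElem.eq]

theorem IsObservable.weight_add_weight {M : Op W} (hM : IsObservable M) (ψ : Ket W) :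
    weight (proj M true *ᵥ ψ) + weight (proj M false *ᵥ ψ) = weight ψ := by
  rw [← Complex.ofReal_inj, Complex.ofReal_add,
    weight_mulVec_of_isStarProjection (hM.isStarProjection_proj _),
    weight_mulVec_of_isStarProjection (hM.isStarProjection_proj _), ← dotProduct_add,
    ← Matrix.add_mulVec, proj_true_add_proj_false, Matrix.one_mulVec, weight_eq_dotProduct]

theorem Anticommute.weight_proj_mulVec {A B : Op W} (hAB : Anticommute A B) (hA : IsObservable A)
    (hB : IsObservable B) (s t : Bool) (ψ : Ket W) :
    weight (proj B t *ᵥ proj A s *ᵥ ψ) = weight (proj A s *ᵥ ψ) / 2 := by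
  have hPA := hA.isStarProjection_proj s
  have hPB := hB.isStarProjection_proj t
  rw [← Complex.ofReal_inj, Matrix.mulVec_mulVec, weight_mulVec, star_mul,
    hPA.isSelfAdjoint.star_eq, hPB.isSelfAdjoint.star_eq, mul_assoc, ← mul_assoc (proj B t),
    hPB.isIdempotentElem.eq, hAB.proj_mul_proj_mul_proj hA, Matrix.smul_mulVec, dotProduct_smul,
    ← weight_mulVec_of_isStarProjection hPA, smul_eq_mul, inv_mul_eq_div]
  push_cast
  rfl

theorem sum_weight_measurements {k : ℕ} (M : Fin k → Op W) (hM : ∀ j, IsObservable (M j))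
    (ψ : Ket W) :
    ∑ o : Fin k → Bool, weight ((List.ofFn fun j => proj (M j) (o j)).reverse.prod *ᵥ ψ) =
      weight ψ := by
  induction k generalizing ψ with
  | zero => simp
  | succ k ih =>
    rw [← (Fin.consEquiv fun _ => Bool).sum_comp, Fintype.sum_prod_type]
    simp only [Fin.consEquiv_apply, List.ofFn_succ, Fin.cons_zero, Fin.cons_succ,
      List.reverse_cons, List.prod_append, List.prod_singleton, ← Matrix.mulVec_mulVec,
      ih (fun j => M j.succ) fun j => hM j.succ, Fintype.sum_bool, (hM 0).weight_add_weight]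

end Measurements

/-! ### The operators and the weights of the steps -/

section StepWeights

variable {n : ℕ}

theorem placement_some_ne_none (e : Placement n) (i : Fin n) : e (some i) ≠ e none :=
  e.injective.ne (Option.some_ne_none i)

theorem Step.isObservable_obs (e : Placement n) (s : Step n) (k : Fin s.arity) :
    IsObservable (s.obs e k).toOp := by
  have hX := isObservable_pauliX
  have hZ := isObservable_pauliZ
  cases s with
  | transfer i U V =>
    change Fin 3 at k
    fin_cases k
    · exact (hX.unitary_conj V).map (onQubit (e none))
    · exact (hZ.unitary_conj_symm U).toOp_two_kronecker (placement_some_ne_none e i)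
        (hZ.unitary_conj V)
    · exact (hX.unitary_conj_symm U).map (onQubit (e (some i)))
  | cnot i j hij =>
    change Fin 4 at k
    fin_cases k
    · exact hZ.map (onQubit (e none))
    · exact hZ.toOp_two_kronecker (placement_some_ne_none e i) hX
    · exact hZ.toOp_two_kronecker (placement_some_ne_none e j).symm hX
    · exact hX.map (onQubit (e none))

theorem Step.sum_weight_kraus (e : Placement n) (s : Step n) (ψ : Ket (Option (Fin n))) :
    ∑ o, weight (s.kraus e o *ᵥ ψ) = weight ψ :=
  sum_weight_measurements (fun k => (s.obs e k).toOp) (s.isObservable_obs e) ψ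

theorem prod_reverse_ofFn_three {M : Type*} [Monoid M] (f : Fin 3 → M) :
    (List.ofFn f).reverse.prod = f 2 * (f 1 * f 0) := by
  simp [List.ofFn_succ]

theorem prod_reverse_ofFn_four {M : Type*} [Monoid M] (f : Fin 4 → M) :
    (List.ofFn f).reverse.prod = f 3 * (f 2 * (f 1 * f 0)) := by
  simp [List.ofFn_succ]

theorem Step.kraus_transfer (e : Placement n) (i : Fin n) (U V : Matrix.unitaryGroup (Fin 2) ℂ)
    (o : Fin 3 → Bool) :
    (Step.transfer i U V).kraus e o =
      proj (onQubit (e (some i)) (U.1ᴴ * pauliX * U.1)) (o 2) *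
      (proj (onQubit (e (some i)) (U.1ᴴ * pauliZ * U.1) *
        onQubit (e none) (V.1 * pauliZ * V.1ᴴ)) (o 1) *
      proj (onQubit (e none) (V.1 * pauliX * V.1ᴴ)) (o 0)) := by
  rw [← toOp_two_kronecker (placement_some_ne_none e i), ← toOp_one, ← toOp_one]
  exact prod_reverse_ofFn_three fun k : Fin 3 => proj (((Step.transfer i U V).obs e) k).toOp (o k)

theorem Step.kraus_cnot (e : Placement n) (i j : Fin n) (hij : i ≠ j) (o : Fin 4 → Bool) :
    (Step.cnot i j hij).kraus e o =
      proj (onQubit (e none) pauliX) (o 3) *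
      (proj (onQubit (e none) pauliZ * onQubit (e (some j)) pauliX) (o 2) *
      (proj (onQubit (e (some i)) pauliZ * onQubit (e none) pauliX) (o 1) *
      proj (onQubit (e none) pauliZ) (o 0))) := by
  rw [← toOp_two_kronecker (placement_some_ne_none e i),
    ← toOp_two_kronecker (placement_some_ne_none e j).symm, ← toOp_one, ← toOp_one]
  exact prod_reverse_ofFn_four fun k : Fin 4 => proj (((Step.cnot i j hij).obs e) k).toOp (o k)

theorem Step.weight_kraus_transfer (e : Placement n) (i : Fin n)
    (U V : Matrix.unitaryGroup (Fin 2) ℂ) (o : Fin 3 → Bool) (ψ : Ket (Option (Fin n))) :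
    weight ((Step.transfer i U V).kraus e o *ᵥ ψ) =
      weight (proj (onQubit (e none) (V.1 * pauliX * V.1ᴴ)) (o 0) *ᵥ ψ) / 4 := by
  have commute_data_aux := onQubit_commute (placement_some_ne_none e i)
  have obs₀ := (isObservable_pauliX.unitary_conj V).map (onQubit (e none))
  have obs₁ := ((isObservable_pauliZ.unitary_conj_symm U).map (onQubit (e (some i)))).mul
    ((isObservable_pauliZ.unitary_conj V).map (onQubit (e none))) (commute_data_aux _ _)
  have obs₂ := (isObservable_pauliX.unitary_conj_symm U).map (onQubit (e (some i)))
  have anticommute₀₁ :=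
    ((anticommute_pauliX_pauliZ.unitary_conj V).map (onQubit (e none))).mul_right
      (commute_data_aux (U.1ᴴ * pauliZ * U.1) _)
  have anticommute₁₂ :=
    ((anticommute_pauliZ_pauliX.unitary_conj_symm U).map (onQubit (e (some i)))).mul_left
      (commute_data_aux _ (V.1 * pauliZ * V.1ᴴ)).symm
  rw [Step.kraus_transfer, ← Matrix.mulVec_mulVec, ← Matrix.mulVec_mulVec,
    anticommute₁₂.weight_proj_mulVec obs₁ obs₂, anticommute₀₁.weight_proj_mulVec obs₀ obs₁]
  ring

/-- The exponents `(x, z)` of the error `X^x Z^z` that a state transfer with the outcomes `o`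
leaves on the data. -/
def transferError (o : Fin 3 → Bool) : Bool × Bool := (!o 1, xor (o 0) (o 2))

theorem Step.sum_weight_kraus_transfer (e : Placement n) (i : Fin n)
    (U V : Matrix.unitaryGroup (Fin 2) ℂ) (p : Bool × Bool) (ψ : Ket (Option (Fin n))) :
    ∑ o with transferError o = p, weight ((Step.transfer i U V).kraus e o *ᵥ ψ) =
      weight ψ / 4 := by
  have outcomes_eq : (Finset.univ.filter fun o : Fin 3 → Bool => transferError o = p) =
      {![true, !p.1, xor true p.2], ![false, !p.1, xor false p.2]} := by
    decide +revert
  rw [← ((isObservable_pauliX.unitary_conj V).map (onQubit (e none))).weight_add_weight ψ,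
    outcomes_eq, Finset.sum_pair fun h => by simpa using congrFun h 0]
  simp only [Step.weight_kraus_transfer, Matrix.cons_val_zero]
  ring

end StepWeights

/-! ### The action of the steps on the data -/

/-- The Pauli operator `X^x Z^z` with the exponents `(x, z) = p`. -/
def pauli (p : Bool × Bool) : Mat1 :=
  (if p.1 then pauliX else 1) * (if p.2 then pauliZ else 1)

section Projections

variable {W : Type} [Fintype W] [DecidableEq W]

theorem proj_mulVec (M : Op W) (s : Bool) (ψ : Ket W) :
    proj M s *ᵥ ψ = (2 : ℂ)⁻¹ • (ψ + outcomeSign s • (M *ᵥ ψ)) := by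
  rw [proj_eq, Matrix.smul_mulVec, Matrix.add_mulVec, Matrix.smul_mulVec, Matrix.one_mulVec]

theorem map_proj {W' : Type} {F : Type*} [Fintype W'] [DecidableEq W'] [FunLike F (Op W) (Op W')]
    [AlgHomClass F ℂ (Op W) (Op W')] (f : F) (M : Op W) (s : Bool) :
    f (proj M s) = proj (f M) s := by
  simp only [proj_eq, map_smul, map_add, map_one]

/-- The projector for the outcome `s` of the measurement of a one-qubit observable, as a matrix on
that qubit. -/
def qubitProj (M : Mat1) (s : Bool) : Mat1 := (2 : ℂ)⁻¹ • (1 + outcomeSign s • M)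

theorem proj_onQubit (a : W) (M : Mat1) (s : Bool) :
    proj (onQubit a M) s = onQubit a (qubitProj M s) := by
  simp only [proj_eq, qubitProj, map_smul, map_add, map_one]

theorem mul_qubitProj {M : Mat1} (hM : M * M = 1) (s : Bool) :
    M * qubitProj M s = outcomeSign s • qubitProj M s := by
  simp only [qubitProj, mul_smul_comm, mul_add, hM, mul_one]
  match_scalars
  · linear_combination -2⁻¹ * outcomeSign_mul_self s
  · ring

theorem qubitProj_mul {M : Mat1} (hM : M * M = 1) (s : Bool) :
    qubitProj M s * M = outcomeSign s • qubitProj M s := by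
  rw [← mul_qubitProj hM, qubitProj, smul_mul_assoc, mul_smul_comm, add_mul, mul_add,
    smul_mul_assoc, mul_smul_comm, one_mul, mul_one]

end Projections

section StepAction

variable {n : ℕ}

theorem update_none_comp_placement (e : Placement n) (x : Option (Fin n) → Fin 2) (t : Fin 2) :
    (fun j => Function.update x (e none) t (e (some j))) = fun j => x (e (some j)) :=
  funext fun j => Function.update_of_ne (placement_some_ne_none e j) _ _

theorem update_some_comp_placement (e : Placement n) (i : Fin n) (x : Option (Fin n) → Fin 2)
    (t : Fin 2) : (fun j => Function.update x (e (some i)) t (e (some j))) =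
      Function.update (fun j => x (e (some j))) i t :=
  Function.update_comp_eq_of_injective x (e.injective.comp (Option.some_injective _)) i t

theorem onQubit_none_mulVec_join (e : Placement n) (M : Mat1) (φ : Ket (Fin n)) (χ : Fin 2 → ℂ) :
    onQubit (e none) M *ᵥ join e φ χ = join e φ (M *ᵥ χ) := by
  funext x
  rw [onQubit_mulVec]
  simp only [join, Matrix.mulVec, dotProduct, Finset.mul_sum, update_none_comp_placement,
    Function.update_self, mul_left_comm]

theorem onQubit_some_mulVec_join (e : Placement n) (i : Fin n) (M : Mat1) (φ : Ket (Fin n))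
    (χ : Fin 2 → ℂ) :
    onQubit (e (some i)) M *ᵥ join e φ χ = join e (onQubit i M *ᵥ φ) χ := by
  funext x
  simp only [onQubit_mulVec, join, Finset.sum_mul, update_some_comp_placement,
    Function.update_of_ne (placement_some_ne_none e i).symm, mul_assoc]

theorem join_smul_left (e : Placement n) (c : ℂ) (φ : Ket (Fin n)) (χ : Fin 2 → ℂ) :
    join e (c • φ) χ = join e φ (c • χ) := by
  funext x
  simp only [join, Pi.smul_apply, smul_eq_mul]
  ring

theorem Step.move_transfer_none (e : Placement n) (i : Fin n)
    (U V : Matrix.unitaryGroup (Fin 2) ℂ) : (Step.transfer i U V).move e none = e (some i) := by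
  simp [Step.move]

theorem Step.move_transfer_some_self (e : Placement n) (i : Fin n)
    (U V : Matrix.unitaryGroup (Fin 2) ℂ) : (Step.transfer i U V).move e (some i) = e none := by
  simp [Step.move]

theorem Step.move_transfer_some_of_ne (e : Placement n) {i j : Fin n} (hji : j ≠ i)
    (U V : Matrix.unitaryGroup (Fin 2) ℂ) :
    (Step.transfer i U V).move e (some j) = e (some j) :=
  congrArg e (Equiv.swap_apply_of_ne_of_ne (by simpa using hji) (by simp))

theorem join_move_transfer (e : Placement n) (i : Fin n) (U V : Matrix.unitaryGroup (Fin 2) ℂ)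
    (φ : Ket (Fin n)) (χ : Fin 2 → ℂ) (x : Option (Fin n) → Fin 2) :
    join ((Step.transfer i U V).move e) φ χ x =
      φ (Function.update (fun j => x (e (some j))) i (x (e none))) * χ (x (e (some i))) := by
  have data_eq : (fun j => x ((Step.transfer i U V).move e (some j))) =
      Function.update (fun j => x (e (some j))) i (x (e none)) := by
    refine Function.eq_update_iff.2 ⟨by rw [Step.move_transfer_some_self], fun j hji => ?_⟩
    rw [Step.move_transfer_some_of_ne e hji]
  rw [join, data_eq, Step.move_transfer_none]

/-- The step `s` with the outcomes `o` applies `L` to the data, up to a scalar that depends only on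
the state of the auxiliary qubit. -/
def Step.Implements (s : Step n) (o : Fin s.arity → Bool) (L : Op (Fin n)) : Prop :=
  ∀ (e : Placement n) (χ : Fin 2 → ℂ), ∃ χ' : Fin 2 → ℂ, ∀ φ : Ket (Fin n),
    s.kraus e o *ᵥ join e φ χ = join (s.move e) (L *ᵥ φ) χ'

theorem Step.Implements.smul {s : Step n} {o : Fin s.arity → Bool} {L : Op (Fin n)}
    (h : s.Implements o L) {c : ℂ} (hc : c ≠ 0) : s.Implements o (c • L) := by
  intro e χ
  obtain ⟨χ', hχ'⟩ := h e χ
  refine ⟨c⁻¹ • χ', fun φ => ?_⟩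
  rw [hχ', Matrix.smul_mulVec, join_smul_left, smul_smul, mul_inv_cancel₀ hc, one_smul]

theorem Step.kraus_transfer_one_one_mulVec_join (e : Placement n) (i : Fin n) (o : Fin 3 → Bool)
    (φ : Ket (Fin n)) (χ : Fin 2 → ℂ) :
    (Step.transfer i 1 1).kraus e o *ᵥ join e φ χ =
      join ((Step.transfer i 1 1).move e) (onQubit i (pauli (transferError o)) *ᵥ φ)
        ((4⁻¹ * (if o 1 then 1 else outcomeSign (o 0)) * (χ 0 + outcomeSign (o 0) * χ 1)) •
          ![1, outcomeSign (o 2)]) := by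
  rw [Step.kraus_transfer]
  simp only [OneMemClass.coe_one, Matrix.conjTranspose_one, one_mul, mul_one,
    ← Matrix.mulVec_mulVec, proj_mulVec, Matrix.mulVec_add, Matrix.mulVec_smul,
    onQubit_none_mulVec_join, onQubit_some_mulVec_join]
  funext x
  simp only [join_move_transfer]
  simp only [join, onQubit_mulVec, Pi.add_apply, Pi.smul_apply, smul_eq_mul, Fin.sum_univ_two,
    Function.update_self, Function.update_idem, transferError]
  generalize hy : (fun j => x (e (some j))) = y
  rw [show x (e (some i)) = y i from congrFun hy i]
  have φ_eq : φ y = φ (Function.update y i (y i)) := by rw [Function.update_eq_self]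
  rw [φ_eq]
  generalize y i = α, x (e none) = β, o 0 = s₀, o 1 = s₁, o 2 = s₂
  fin_cases α <;> fin_cases β <;> cases s₀ <;> cases s₁ <;> cases s₂ <;>
    simp [pauliX, pauliZ, pauli, outcomeSign, Matrix.mulVec, dotProduct] <;> ring

theorem Step.kraus_transfer_eq_conj (e : Placement n) (i : Fin n)
    (U V : Matrix.unitaryGroup (Fin 2) ℂ) (o : Fin 3 → Bool) :
    (Step.transfer i U V).kraus e o =
      (onQubit (e (some i)) U.1ᴴ * onQubit (e none) V.1) * (Step.transfer i 1 1).kraus e o *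
        (onQubit (e (some i)) U.1 * onQubit (e none) V.1ᴴ) := by
  have data_aux_commute := onQubit_commute (placement_some_ne_none e i)
  let W : Matrix.unitaryGroup (Option (Fin n) → Fin 2) ℂ :=
    ⟨_, mul_mem (onQubit_mem_unitary (e (some i)) (star U).2) (onQubit_mem_unitary (e none) V.2)⟩
  have star_W : star W.1 = onQubit (e (some i)) U.1 * onQubit (e none) V.1ᴴ := by
    rw [star_mul, ← map_star, ← map_star, Unitary.coe_star, star_star,
      ← Matrix.star_eq_conjTranspose, (data_aux_commute _ _).eq]
  let conj := Unitary.conjStarAlgAut ℂ (Op (Option (Fin n))) W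
  have conj_mul (A B : Mat1) : conj (onQubit (e (some i)) A * onQubit (e none) B) =
      onQubit (e (some i)) (U.1ᴴ * A * U.1) * onQubit (e none) (V.1 * B * V.1ᴴ) := by
    rw [Unitary.conjStarAlgAut_apply, star_W, (data_aux_commute _ _).symm.mul_mul_mul_comm,
      ← map_mul, ← map_mul, (data_aux_commute _ _).symm.mul_mul_mul_comm, ← map_mul, ← map_mul]
    rfl
  have conj_data (A : Mat1) : conj (onQubit (e (some i)) A) =
      onQubit (e (some i)) (U.1ᴴ * A * U.1) := by
    simpa [← Matrix.star_eq_conjTranspose] using conj_mul A 1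
  have conj_aux (B : Mat1) : conj (onQubit (e none) B) =
      onQubit (e none) (V.1 * B * V.1ᴴ) := by
    simpa [← Matrix.star_eq_conjTranspose] using conj_mul 1 B
  calc (Step.transfer i U V).kraus e o = conj ((Step.transfer i 1 1).kraus e o) := by
        simp only [Step.kraus_transfer, map_mul, map_proj, conj_data, conj_aux,
          OneMemClass.coe_one, Matrix.conjTranspose_one, one_mul, mul_one]
    _ = _ := by rw [Unitary.conjStarAlgAut_apply, star_W]; rfl

theorem Step.implements_transfer (i : Fin n) (U V : Matrix.unitaryGroup (Fin 2) ℂ)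
    (o : Fin 3 → Bool) :
    (Step.transfer i U V).Implements o (onQubit i (V.1 * pauli (transferError o) * U.1)) := by
  intro e χ
  refine ⟨U.1ᴴ *ᵥ ((4⁻¹ * (if o 1 then 1 else outcomeSign (o 0)) *
    ((V.1ᴴ *ᵥ χ) 0 + outcomeSign (o 0) * (V.1ᴴ *ᵥ χ) 1)) • ![1, outcomeSign (o 2)]), fun φ => ?_⟩
  rw [Step.kraus_transfer_eq_conj]
  simp only [← Matrix.mulVec_mulVec, onQubit_none_mulVec_join, onQubit_some_mulVec_join,
    Step.kraus_transfer_one_one_mulVec_join]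
  rw [← Step.move_transfer_some_self e i 1 1, onQubit_some_mulVec_join,
    ← Step.move_transfer_none e i 1 1, onQubit_none_mulVec_join]
  simp only [map_mul, ← Matrix.mulVec_mulVec]
  rfl

theorem onQubit_pauliZ_mulVec {W : Type} [Fintype W] [DecidableEq W] (a : W) (ψ : Ket W)
    (x : W → Fin 2) : (onQubit a pauliZ *ᵥ ψ) x = (if x a = 0 then 1 else -1) * ψ x := by
  rw [show pauliZ = Matrix.diagonal fun t => if t = 0 then 1 else -1 by
    ext s t; fin_cases s <;> fin_cases t <;> simp [pauliZ], onQubit_diagonal,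
    Matrix.mulVec_diagonal]

theorem onQubit_pauliX_mulVec {W : Type} [Fintype W] [DecidableEq W] (a : W) (ψ : Ket W)
    (x : W → Fin 2) : (onQubit a pauliX *ᵥ ψ) x = ψ (Function.update x a (1 + x a)) := by
  have pauliX_apply (s t : Fin 2) : pauliX s t = if t = 1 + s then 1 else 0 := by
    fin_cases s <;> fin_cases t <;> simp [pauliX]
  simp [onQubit_mulVec, pauliX_apply]

theorem cnotOp_eq {W : Type} [Fintype W] [DecidableEq W] {a b : W} (hab : a ≠ b) :
    cnotOp hab = (2 : ℂ)⁻¹ • (1 + onQubit a pauliZ + onQubit b pauliX -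
      onQubit b pauliX * onQubit a pauliZ) := by
  refine Matrix.ext_iff_mulVec.2 fun ψ => funext fun x => ?_
  simp only [cnotOp_mulVec, Matrix.smul_mulVec, Matrix.sub_mulVec, Matrix.add_mulVec,
    Matrix.one_mulVec, ← Matrix.mulVec_mulVec, onQubit_pauliZ_mulVec, onQubit_pauliX_mulVec,
    Pi.smul_apply, Pi.sub_apply, Pi.add_apply, smul_eq_mul, Function.update_of_ne hab]
  rcases Fin.eq_zero_or_eq_succ (x a) with ha | ⟨t, ha⟩
  · simp only [ha, zero_add, Function.update_eq_self, if_true]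
    ring
  · obtain rfl := Subsingleton.elim t 0
    simp only [ha, Fin.succ_zero_eq_one, one_ne_zero, if_false]
    ring

/-- Pauli operators that follow a controlled-not change the signs of its expansion `cnotOp_eq`. -/
theorem pauli_mul_cnotOp {W : Type} [Fintype W] [DecidableEq W] {a b : W} (hab : a ≠ b)
    (p q : Bool) :
    onQubit a (pauli (false, !q)) * onQubit b (pauli (!p, false)) * cnotOp hab =
      ((if !q && !p then (-1 : ℂ) else 1) * 2⁻¹) • (1 + outcomeSign p • onQubit a pauliZ +
        outcomeSign q • onQubit b pauliX -
        (outcomeSign p * outcomeSign q) • (onQubit b pauliX * onQubit a pauliZ)) := by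
  have hZ : onQubit a pauliZ * onQubit a pauliZ = 1 :=
    (isObservable_pauliZ.map (onQubit a)).mul_self
  have hX : onQubit b pauliX * onQubit b pauliX = 1 :=
    (isObservable_pauliX.map (onQubit b)).mul_self
  have hZX := (onQubit_commute hab pauliZ pauliX).eq
  have hXX (M : Op W) : onQubit b pauliX * (onQubit b pauliX * M) = M := by
    rw [← mul_assoc, hX, one_mul]
  have hZXZ (M : Op W) : onQubit a pauliZ * (onQubit b pauliX * M) =
      onQubit b pauliX * (onQubit a pauliZ * M) := by
    rw [← mul_assoc, hZX, mul_assoc]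
  rw [cnotOp_eq]
  cases p <;> cases q <;>
    simp [pauli, outcomeSign, mul_add, mul_sub, mul_assoc, hZ, hX, hZX, hXX, hZXZ] <;> module

theorem Step.kraus_cnot_eq (e : Placement n) (i j : Fin n) (hij : i ≠ j) (o : Fin 4 → Bool) :
    (Step.cnot i j hij).kraus e o = (4 : ℂ)⁻¹ •
      ((1 + (outcomeSign (o 1) * outcomeSign (o 3)) • onQubit (e (some i)) pauliZ +
        (outcomeSign (o 0) * outcomeSign (o 2)) • onQubit (e (some j)) pauliX -
        (outcomeSign (o 1) * outcomeSign (o 3) * (outcomeSign (o 0) * outcomeSign (o 2))) •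
          (onQubit (e (some j)) pauliX * onQubit (e (some i)) pauliZ)) *
        onQubit (e none) (qubitProj pauliX (o 3) * qubitProj pauliZ (o 0))) := by
  have X_sq := isObservable_pauliX.mul_self
  have Z_sq := isObservable_pauliZ.mul_self
  have ZX_eq : pauliZ * pauliX = -(pauliX * pauliZ) := anticommute_pauliZ_pauliX
  have commute_i := onQubit_commute (placement_some_ne_none e i) pauliZ
  have commute_j := onQubit_commute (placement_some_ne_none e j) pauliX
  rw [Step.kraus_cnot, proj_onQubit, proj_onQubit, proj_eq, proj_eq]
  set PX := qubitProj pauliX (o 3)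
  set PZ := qubitProj pauliZ (o 0)
  have PX_Z_PZ : PX * (pauliZ * PZ) = outcomeSign (o 0) • (PX * PZ) := by
    rw [mul_qubitProj Z_sq, mul_smul_comm]
  have PX_X_PZ : PX * (pauliX * PZ) = outcomeSign (o 3) • (PX * PZ) := by
    rw [← mul_assoc, qubitProj_mul X_sq, smul_mul_assoc]
  have PX_ZX_PZ : PX * (pauliZ * (pauliX * PZ)) =
      -((outcomeSign (o 0) * outcomeSign (o 3)) • (PX * PZ)) := by
    rw [← mul_assoc pauliZ, ZX_eq, neg_mul, mul_neg, mul_assoc, mul_qubitProj Z_sq,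
      mul_smul_comm, mul_smul_comm, PX_X_PZ, smul_smul]
  have move_A (M : Mat1) (N : Op (Option (Fin n))) := (commute_i M).symm.left_comm N
  have move_B (M : Mat1) (N : Op (Option (Fin n))) := (commute_j M).symm.left_comm N
  simp only [smul_mul_assoc, mul_smul_comm, add_mul, sub_mul, mul_add, one_mul, mul_assoc, move_A,
    move_B, ← map_mul]
  simp only [PX_Z_PZ, PX_X_PZ, PX_ZX_PZ, map_smul, map_neg, mul_smul_comm, mul_neg]
  module

theorem outcomeSign_not_xor (s t : Bool) :
    outcomeSign (!xor s t) = outcomeSign s * outcomeSign t := by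
  cases s <;> cases t <;> simp [outcomeSign]

theorem Step.implements_cnot {i j : Fin n} (hij : i ≠ j) (o : Fin 4 → Bool) :
    (Step.cnot i j hij).Implements o (onQubit i (pauli (false, xor (o 0) (o 2))) *
      onQubit j (pauli (xor (o 1) (o 3), false)) * cnotOp hij) := by
  have cnot_eq := pauli_mul_cnotOp hij (!xor (o 1) (o 3)) (!xor (o 0) (o 2))
  rw [Bool.not_not, Bool.not_not, outcomeSign_not_xor, outcomeSign_not_xor] at cnot_eq
  rw [cnot_eq]
  refine Step.Implements.smul (fun e χ => ⟨(4 : ℂ)⁻¹ •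
    ((qubitProj pauliX (o 3) * qubitProj pauliZ (o 0)) *ᵥ χ), fun φ => ?_⟩)
    (by split_ifs <;> norm_num)
  rw [Step.kraus_cnot_eq]
  simp only [Matrix.smul_mulVec, ← Matrix.mulVec_mulVec, onQubit_none_mulVec_join,
    Matrix.add_mulVec, Matrix.sub_mulVec, Matrix.one_mulVec, onQubit_some_mulVec_join]
  funext x
  simp only [Step.move, join, Pi.add_apply, Pi.smul_apply, Pi.sub_apply, smul_eq_mul]
  ring

end StepAction

namespace Automaton

variable {n : ℕ}

theorem haltWeight_of_halting (A : Automaton n) {q : A.State} (h : A.action q = none) (N : ℕ)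
    (e : Placement n) (ψ : Ket (Option (Fin n))) : A.haltWeight N q e ψ = weight ψ := by
  cases N <;> simp [haltWeight, h]

theorem haltWeight_zero_of_step (A : Automaton n) {q : A.State} {a} (h : A.action q = some a)
    (e : Placement n) (ψ : Ket (Option (Fin n))) : A.haltWeight 0 q e ψ = 0 := by
  simp [haltWeight, h]

theorem haltWeight_succ_of_step (A : Automaton n) {q : A.State} {s : Step n}
    {next : (Fin s.arity → Bool) → A.State} (h : A.action q = some ⟨s, next⟩) (N : ℕ)
    (e : Placement n) (ψ : Ket (Option (Fin n))) :
    A.haltWeight (N + 1) q e ψ =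
      ∑ o, A.haltWeight N (next o) (s.move e) (s.kraus e o *ᵥ ψ) := by
  simp [haltWeight, h]

theorem haltWeight_nonneg (A : Automaton n) (N : ℕ) (q : A.State) (e : Placement n)
    (ψ : Ket (Option (Fin n))) : 0 ≤ A.haltWeight N q e ψ := by
  induction N generalizing q e ψ with
  | zero =>
    rcases h : A.action q with _ | a
    · exact (weight_nonneg ψ).trans_eq (A.haltWeight_of_halting h _ e ψ).symm
    · exact (A.haltWeight_zero_of_step h e ψ).ge
  | succ N ih =>
    rcases h : A.action q with _ | ⟨s, next⟩
    · exact (weight_nonneg ψ).trans_eq (A.haltWeight_of_halting h _ e ψ).symm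
    · rw [A.haltWeight_succ_of_step h]
      exact Finset.sum_nonneg fun o _ => ih _ _ _

theorem haltWeight_le_weight (A : Automaton n) (N : ℕ) (q : A.State) (e : Placement n)
    (ψ : Ket (Option (Fin n))) : A.haltWeight N q e ψ ≤ weight ψ := by
  induction N generalizing q e ψ with
  | zero =>
    rcases h : A.action q with _ | a
    · exact (A.haltWeight_of_halting h _ e ψ).le
    · exact (A.haltWeight_zero_of_step h e ψ).trans_le (weight_nonneg ψ)
  | succ N ih =>
    rcases h : A.action q with _ | ⟨s, next⟩
    · exact (A.haltWeight_of_halting h _ e ψ).le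
    · rw [A.haltWeight_succ_of_step h, ← s.sum_weight_kraus e ψ]
      exact Finset.sum_le_sum fun o _ => ih _ _ _

theorem haltWeight_mono (A : Automaton n) (q : A.State) (e : Placement n)
    (ψ : Ket (Option (Fin n))) : Monotone fun N => A.haltWeight N q e ψ := by
  refine monotone_nat_of_le_succ fun N => ?_
  induction N generalizing q e ψ with
  | zero =>
    rcases h : A.action q with _ | a
    · rw [A.haltWeight_of_halting h, A.haltWeight_of_halting h]
    · exact (A.haltWeight_zero_of_step h e ψ).trans_le (A.haltWeight_nonneg _ _ _ _)
  | succ N ih =>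
    rcases h : A.action q with _ | ⟨s, next⟩
    · rw [A.haltWeight_of_halting h, A.haltWeight_of_halting h]
    · rw [A.haltWeight_succ_of_step h, A.haltWeight_succ_of_step h]
      exact Finset.sum_le_sum fun o _ => ih _ _ _

/-- From every state, and whatever the state of the register, the automaton halts within a bounded
number of steps with a probability bounded below. -/
def HaltsUniformly (A : Automaton n) : Prop :=
  ∃ (N : ℕ) (δ : ℝ), 0 < δ ∧
    ∀ (q : A.State) (e : Placement n) (ψ : Ket (Option (Fin n))),
      δ * weight ψ ≤ A.haltWeight N q e ψ

theorem weight_sub_haltWeight_add_le (A : Automaton n) {M : ℕ} {c : ℝ}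
    (hM : ∀ q e ψ, weight ψ - A.haltWeight M q e ψ ≤ c * weight ψ) (N : ℕ) (q : A.State)
    (e : Placement n) (ψ : Ket (Option (Fin n))) :
    weight ψ - A.haltWeight (N + M) q e ψ ≤ c * (weight ψ - A.haltWeight N q e ψ) := by
  induction N generalizing q e ψ with
  | zero =>
    rcases h : A.action q with _ | a
    · simp [A.haltWeight_of_halting h]
    · simpa [A.haltWeight_zero_of_step h] using hM q e ψ
  | succ N ih =>
    rcases h : A.action q with _ | ⟨s, next⟩
    · simp [A.haltWeight_of_halting h]
    · rw [show N + 1 + M = N + M + 1 by ring, A.haltWeight_succ_of_step h,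
        A.haltWeight_succ_of_step h, ← s.sum_weight_kraus e ψ, ← Finset.sum_sub_distrib,
        ← Finset.sum_sub_distrib, Finset.mul_sum]
      exact Finset.sum_le_sum fun o _ => ih _ _ _

theorem weight_sub_haltWeight_mul_le (A : Automaton n) {M : ℕ} {c : ℝ} (hc : 0 ≤ c)
    (hM : ∀ q e ψ, weight ψ - A.haltWeight M q e ψ ≤ c * weight ψ) (k : ℕ) (q : A.State)
    (e : Placement n) (ψ : Ket (Option (Fin n))) :
    weight ψ - A.haltWeight (k * M) q e ψ ≤ c ^ k * weight ψ := by
  induction k with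
  | zero => simpa using A.haltWeight_nonneg _ q e ψ
  | succ k ih =>
    rw [add_one_mul, pow_succ', mul_assoc]
    exact (A.weight_sub_haltWeight_add_le hM (k * M) q e ψ).trans
      (mul_le_mul_of_nonneg_left ih hc)

theorem HaltsUniformly.tendsto {A : Automaton n} (hA : A.HaltsUniformly) (q : A.State)
    (e : Placement n) (ψ : Ket (Option (Fin n))) :
    Filter.Tendsto (fun N => A.haltWeight N q e ψ) Filter.atTop (𝓝 (weight ψ)) := by
  obtain ⟨M, δ, δ_pos, hM⟩ := hA
  wlog δ_le_one : δ ≤ 1 generalizing δ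
  · refine this 1 one_pos (fun q e ψ => le_trans ?_ (hM q e ψ)) le_rfl
    exact mul_le_mul_of_nonneg_right (not_le.1 δ_le_one).le (weight_nonneg ψ)
  have decay (k : ℕ) :
      weight ψ - (1 - δ) ^ k * weight ψ ≤ A.haltWeight (k * (M + 1)) q e ψ := by
    refine sub_le_comm.1 (A.weight_sub_haltWeight_mul_le (sub_nonneg.2 δ_le_one) ?_ k q e ψ)
    intro q e ψ
    linarith [hM q e ψ, A.haltWeight_mono q e ψ M.le_succ]
  have lower_tendsto : Filter.Tendsto (fun k : ℕ => weight ψ - (1 - δ) ^ k * weight ψ)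
      Filter.atTop (𝓝 (weight ψ)) := by
    simpa using ((tendsto_pow_atTop_nhds_zero_of_lt_one (sub_nonneg.2 δ_le_one)
      (sub_lt_self 1 δ_pos)).mul_const (weight ψ)).const_sub (weight ψ)
  rw [tendsto_iff_tendsto_subseq_of_monotone (A.haltWeight_mono q e ψ)
    (Filter.tendsto_id.atTop_mul_const' M.succ_pos)]
  exact tendsto_of_tendsto_of_tendsto_of_le_of_le lower_tendsto tendsto_const_nhds decay
    fun k => A.haltWeight_le_weight _ q e ψ

/-! ### Correctness of automata -/

/-- The invariant `inv` proves that the automaton applies `U` to the data: in the state `q`, the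
operator `inv q` has been applied. -/
structure Realizes (A : Automaton n) (U : Op (Fin n)) (inv : A.State → Op (Fin n)) : Prop where
  start : inv A.start = 1
  step : ∀ q s next, A.action q = some ⟨s, next⟩ → ∀ o, ∃ L, s.Implements o L ∧
    inv (next o) = L * inv q
  halt : ∀ q, A.action q = none → ∃ c : ℂ, c ≠ 0 ∧ inv q = c • U

theorem Realizes.simulates {A : Automaton n} {U : Op (Fin n)} {inv : A.State → Op (Fin n)}
    (h : A.Realizes U inv) (hA : A.HaltsUniformly) : A.Simulates U := by
  refine ⟨fun φ χ => hA.tendsto _ _ _, fun q e K hK hq χ => ?_⟩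
  have inv_holds : ∃ χ' : Fin 2 → ℂ, ∀ φ : Ket (Fin n),
      K *ᵥ join (Equiv.refl _) φ χ = join e (inv q *ᵥ φ) χ' := by
    clear hq
    induction hK with
    | init => exact ⟨χ, fun φ => by rw [h.start, Matrix.one_mulVec, Matrix.one_mulVec]⟩
    | step o _ hq ih =>
      obtain ⟨χ₁, hχ₁⟩ := ih
      obtain ⟨L, hL, inv_next⟩ := h.step _ _ _ hq o
      obtain ⟨χ₂, hχ₂⟩ := hL _ χ₁
      exact ⟨χ₂, fun φ => by
        rw [← Matrix.mulVec_mulVec, hχ₁, hχ₂, inv_next, Matrix.mulVec_mulVec]⟩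
  obtain ⟨χ', hχ'⟩ := inv_holds
  obtain ⟨c, -, inv_halt⟩ := h.halt q hq
  exact ⟨c • χ', fun φ => by rw [hχ', inv_halt, Matrix.smul_mulVec, join_smul_left]⟩

/-- A step with renamed next states. -/
def mapAction {S T : Type} (f : S → T) (a : Σ s : Step n, (Fin s.arity → Bool) → S) :
    Σ s : Step n, (Fin s.arity → Bool) → T := ⟨a.1, fun o => f (a.2 o)⟩

theorem haltWeight_map {A B : Automaton n} (f : B.State → A.State)
    (hf : ∀ q, A.action (f q) = (B.action q).map (mapAction f)) (N : ℕ) (q : B.State)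
    (e : Placement n) (ψ : Ket (Option (Fin n))) :
    A.haltWeight N (f q) e ψ = B.haltWeight N q e ψ := by
  induction N generalizing q e ψ with
  | zero =>
    rcases h : B.action q with _ | a
    · rw [B.haltWeight_of_halting h, A.haltWeight_of_halting (by rw [hf, h]; rfl)]
    · rw [B.haltWeight_zero_of_step h, A.haltWeight_zero_of_step (by rw [hf, h]; rfl)]
  | succ N ih =>
    rcases h : B.action q with _ | ⟨s, next⟩
    · rw [B.haltWeight_of_halting h, A.haltWeight_of_halting (by rw [hf, h]; rfl)]
    · rw [B.haltWeight_succ_of_step h,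
        A.haltWeight_succ_of_step (s := s) (next := fun o => f (next o)) (by rw [hf, h]; rfl)]
      exact Finset.sum_congr rfl fun o _ => ih _ _ _

theorem haltWeight_congr (A : Automaton n) {q q' : A.State} (h : A.action q = A.action q') (N : ℕ)
    (e : Placement n) (ψ : Ket (Option (Fin n))) :
    A.haltWeight N q e ψ = A.haltWeight N q' e ψ := by
  cases N <;> simp [haltWeight, h]

theorem map_mapAction_eq_some {S T : Type} {f : S → T}
    {x : Option (Σ s : Step n, (Fin s.arity → Bool) → S)} {s : Step n}
    {next : (Fin s.arity → Bool) → T} (h : x.map (mapAction f) = some ⟨s, next⟩) :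
    ∃ next', x = some ⟨s, next'⟩ ∧ next = fun o => f (next' o) := by
  rcases x with _ | ⟨s', next'⟩
  · simp at h
  · simp only [Option.map_some, mapAction, Option.some.injEq] at h
    cases h
    exact ⟨next', rfl, rfl⟩

/-- The automaton that runs `A` and then `B`. -/
def seq (A B : Automaton n) : Automaton n where
  State := A.State ⊕ B.State
  finite := by
    have := A.finite
    have := B.finite
    infer_instance
  start := Sum.inl A.start
  action
    | Sum.inl q =>
      match A.action q with
      | some a => some (mapAction Sum.inl a)
      | none => (B.action B.start).map (mapAction Sum.inr)
    | Sum.inr q => (B.action q).map (mapAction Sum.inr)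

theorem seq_action_inl_some (A B : Automaton n) {q : A.State} {a} (h : A.action q = some a) :
    (A.seq B).action (Sum.inl q) = some (mapAction Sum.inl a) := by
  simp [seq, h]

theorem seq_action_inl_none (A B : Automaton n) {q : A.State} (h : A.action q = none) :
    (A.seq B).action (Sum.inl q) = (B.action B.start).map (mapAction Sum.inr) := by
  simp [seq, h]

theorem UsesOnly.seq {A B : Automaton n} {O : Family} (hA : A.UsesOnly O) (hB : B.UsesOnly O) :
    (A.seq B).UsesOnly O := by
  rintro (q | q) s next h
  · rcases hq : A.action q with _ | ⟨s', next'⟩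
    · rw [seq_action_inl_none A B hq] at h
      obtain ⟨next', h', -⟩ := map_mapAction_eq_some h
      exact hB _ _ _ h'
    · rw [seq_action_inl_some A B hq] at h
      simp only [mapAction] at h
      cases h
      exact hA _ _ _ hq
  · obtain ⟨next', h', -⟩ := map_mapAction_eq_some h
    exact hB _ _ _ h'

theorem haltWeight_seq_inr (A B : Automaton n) (N : ℕ) (q : B.State) (e : Placement n)
    (ψ : Ket (Option (Fin n))) :
    (A.seq B).haltWeight N (Sum.inr q) e ψ = B.haltWeight N q e ψ :=
  haltWeight_map (A := A.seq B) Sum.inr (fun _ => rfl) N q e ψ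

theorem mul_haltWeight_le_haltWeight_seq_inl (A B : Automaton n) {M : ℕ} {δ : ℝ}
    (hM : ∀ e ψ, δ * weight ψ ≤ B.haltWeight M B.start e ψ) (N : ℕ) (q : A.State)
    (e : Placement n) (ψ : Ket (Option (Fin n))) :
    δ * A.haltWeight N q e ψ ≤ (A.seq B).haltWeight (N + M) (Sum.inl q) e ψ := by
  have of_halting (N : ℕ) (q : A.State) (e ψ) (h : A.action q = none) :
      δ * A.haltWeight N q e ψ ≤ (A.seq B).haltWeight (N + M) (Sum.inl q) e ψ := by
    rw [A.haltWeight_of_halting h, (A.seq B).haltWeight_congr (q' := Sum.inr B.start)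
      (seq_action_inl_none A B h), haltWeight_seq_inr]
    exact (hM e ψ).trans (B.haltWeight_mono _ e ψ (Nat.le_add_left M N))
  induction N generalizing q e ψ with
  | zero =>
    rcases h : A.action q with _ | a
    · exact of_halting _ _ _ _ h
    · rw [A.haltWeight_zero_of_step h, mul_zero]
      exact haltWeight_nonneg _ _ _ _ _
  | succ N ih =>
    rcases h : A.action q with _ | ⟨s, next⟩
    · exact of_halting _ _ _ _ h
    · rw [A.haltWeight_succ_of_step h, Nat.add_right_comm,
        (A.seq B).haltWeight_succ_of_step (seq_action_inl_some A B h), Finset.mul_sum]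
      exact Finset.sum_le_sum fun o _ => ih _ _ _

theorem HaltsUniformly.seq {A B : Automaton n} (hA : A.HaltsUniformly) (hB : B.HaltsUniformly) :
    (A.seq B).HaltsUniformly := by
  obtain ⟨M, δ, δ_pos, hM⟩ := hA
  obtain ⟨M', δ', δ'_pos, hM'⟩ := hB
  refine ⟨M + M', min (δ' * δ) δ', lt_min (mul_pos δ'_pos δ_pos) δ'_pos, ?_⟩
  rintro (q | q) e ψ
  · calc min (δ' * δ) δ' * weight ψ ≤ δ' * δ * weight ψ :=
          mul_le_mul_of_nonneg_right (min_le_left _ _) (weight_nonneg ψ)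
      _ = δ' * (δ * weight ψ) := mul_assoc _ _ _
      _ ≤ δ' * A.haltWeight M q e ψ := mul_le_mul_of_nonneg_left (hM q e ψ) δ'_pos.le
      _ ≤ (A.seq B).haltWeight (M + M') (Sum.inl q) e ψ :=
          mul_haltWeight_le_haltWeight_seq_inl A B (hM' B.start) M q e ψ
  · calc min (δ' * δ) δ' * weight ψ ≤ δ' * weight ψ :=
          mul_le_mul_of_nonneg_right (min_le_right _ _) (weight_nonneg ψ)
      _ ≤ B.haltWeight M' q e ψ := hM' q e ψ
      _ ≤ B.haltWeight (M + M') q e ψ := B.haltWeight_mono q e ψ (Nat.le_add_left M' M)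
      _ = (A.seq B).haltWeight (M + M') (Sum.inr q) e ψ :=
          (haltWeight_seq_inr A B _ q e ψ).symm

theorem Realizes.seq {A B : Automaton n} {U V : Op (Fin n)} {invA : A.State → Op (Fin n)}
    {invB : B.State → Op (Fin n)} (hA : A.Realizes U invA) (hB : B.Realizes V invB) :
    (A.seq B).Realizes (V * U) (Sum.elim invA fun q => invB q * U) where
  start := hA.start
  step := by
    rintro (q | q) s next h o
    · rcases hq : A.action q with _ | ⟨s', next'⟩
      · rw [seq_action_inl_none A B hq] at h
        obtain ⟨next', h', rfl⟩ := map_mapAction_eq_some h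
        obtain ⟨L, hL, inv_next⟩ := hB.step _ _ _ h' o
        obtain ⟨c, hc, invA_halt⟩ := hA.halt q hq
        refine ⟨c⁻¹ • L, hL.smul (inv_ne_zero hc), ?_⟩
        simp only [Sum.elim_inl, Sum.elim_inr]
        rw [inv_next, hB.start, invA_halt, smul_mul_smul_comm, inv_mul_cancel₀ hc,
          one_smul, mul_one]
      · rw [seq_action_inl_some A B hq] at h
        simp only [mapAction] at h
        cases h
        exact hA.step _ _ _ hq o
    · obtain ⟨next', h', rfl⟩ := map_mapAction_eq_some h
      obtain ⟨L, hL, inv_next⟩ := hB.step _ _ _ h' o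
      exact ⟨L, hL, by simp only [Sum.elim_inr]; rw [inv_next, mul_assoc]⟩
  halt := by
    rintro (q | q) h
    · rcases hq : A.action q with _ | a
      · rw [seq_action_inl_none A B hq] at h
        replace h := Option.map_eq_none_iff.1 h
        obtain ⟨c, hc, invA_halt⟩ := hA.halt q hq
        obtain ⟨d, hd, invB_halt⟩ := hB.halt _ h
        refine ⟨c * d, mul_ne_zero hc hd, ?_⟩
        rw [hB.start] at invB_halt
        rw [Sum.elim_inl, invA_halt, mul_smul, ← smul_mul_assoc d, ← invB_halt,
          one_mul]
      · rw [seq_action_inl_some A B hq] at h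
        simp at h
    · have h' : B.action q = none := Option.map_eq_none_iff.1 h
      obtain ⟨d, hd, invB_halt⟩ := hB.halt _ h'
      exact ⟨d, hd, by rw [Sum.elim_inr, invB_halt, smul_mul_assoc]⟩

/-- The automaton that performs the step `s` and then runs the automaton chosen by the outcomes. -/
def stepThen (s : Step n) (B : (Fin s.arity → Bool) → Automaton n) : Automaton n where
  State := Option (Σ o, (B o).State)
  finite := by
    have := fun o => (B o).finite
    infer_instance
  start := none
  action
    | none => some ⟨s, fun o => some ⟨o, (B o).start⟩⟩
    | some q => ((B q.1).action q.2).map (mapAction fun q' => some ⟨q.1, q'⟩)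

theorem UsesOnly.stepThen {s : Step n} {B : (Fin s.arity → Bool) → Automaton n} {O : Family}
    (hs : ∀ (e : Placement n) (k : Fin s.arity), (s.obs e k).MemFamily O)
    (hB : ∀ o, (B o).UsesOnly O) : (stepThen s B).UsesOnly O := by
  rintro (_ | ⟨o, q⟩) s' next h
  · simp only [Automaton.stepThen, Option.some.injEq] at h
    cases h
    exact hs
  · obtain ⟨next', h', -⟩ := map_mapAction_eq_some h
    exact hB _ _ _ _ h'

theorem haltWeight_stepThen_some (s : Step n) (B : (Fin s.arity → Bool) → Automaton n) (N : ℕ)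
    (o : Fin s.arity → Bool) (q : (B o).State) (e : Placement n) (ψ : Ket (Option (Fin n))) :
    (stepThen s B).haltWeight N (some ⟨o, q⟩) e ψ = (B o).haltWeight N q e ψ :=
  haltWeight_map (A := stepThen s B) (fun q => some ⟨o, q⟩) (fun _ => rfl) N q e ψ

theorem haltWeight_stepThen_none (s : Step n) (B : (Fin s.arity → Bool) → Automaton n) (N : ℕ)
    (e : Placement n) (ψ : Ket (Option (Fin n))) :
    (stepThen s B).haltWeight (N + 1) none e ψ =
      ∑ o, (stepThen s B).haltWeight N (some ⟨o, (B o).start⟩) (s.move e) (s.kraus e o *ᵥ ψ) :=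
  haltWeight_succ_of_step (stepThen s B) rfl N e ψ

theorem HaltsUniformly.stepThen {s : Step n} {B : (Fin s.arity → Bool) → Automaton n}
    (hB : ∀ o, (B o).HaltsUniformly) : (stepThen s B).HaltsUniformly := by
  choose N δ δ_pos hN using hB
  obtain ⟨o₀, δ_min⟩ := Finite.exists_min δ
  have of_some (o) (q : (B o).State) (e ψ) :
      δ o₀ * weight ψ ≤ (Automaton.stepThen s B).haltWeight (∑ o, N o) (some ⟨o, q⟩) e ψ := by
    rw [haltWeight_stepThen_some]
    calc δ o₀ * weight ψ ≤ δ o * weight ψ :=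
          mul_le_mul_of_nonneg_right (δ_min o) (weight_nonneg ψ)
      _ ≤ (B o).haltWeight (N o) q e ψ := hN o q e ψ
      _ ≤ (B o).haltWeight (∑ o, N o) q e ψ := (B o).haltWeight_mono q e ψ
          (Finset.single_le_sum (fun _ _ => Nat.zero_le _) (Finset.mem_univ o))
  refine ⟨(∑ o, N o) + 1, δ o₀, δ_pos o₀, ?_⟩
  rintro (_ | ⟨o, q⟩) e ψ
  · refine le_of_le_of_eq ?_ (haltWeight_stepThen_none s B _ e ψ).symm
    rw [← s.sum_weight_kraus e ψ, Finset.mul_sum]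
    exact Finset.sum_le_sum fun o _ => of_some _ _ _ _
  · exact (of_some o q e ψ).trans
      ((Automaton.stepThen s B).haltWeight_mono _ e ψ (Nat.le_succ _))

theorem Realizes.stepThen {s : Step n} {B : (Fin s.arity → Bool) → Automaton n}
    {U : Op (Fin n)} {L V : (Fin s.arity → Bool) → Op (Fin n)}
    {inv : ∀ o, (B o).State → Op (Fin n)} (hs : ∀ o, s.Implements o (L o))
    (hB : ∀ o, (B o).Realizes (V o) (inv o))
    (hU : ∀ o, ∃ c : ℂ, c ≠ 0 ∧ V o * L o = c • U) :
    (stepThen s B).Realizes U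
      (fun q => q.elim 1 fun q => inv q.1 q.2 * L q.1) where
  start := rfl
  step := by
    rintro (_ | ⟨o, q⟩) s' next h o'
    · simp only [Automaton.stepThen, Option.some.injEq] at h
      cases h
      exact ⟨L o', hs o', by simp [(hB o').start]⟩
    · obtain ⟨next', h', rfl⟩ := map_mapAction_eq_some h
      obtain ⟨M, hM, inv_next⟩ := (hB o).step _ _ _ h' o'
      exact ⟨M, hM, by simp only [Option.elim_some]; rw [inv_next, mul_assoc]⟩
  halt := by
    rintro (_ | ⟨o, q⟩) h
    · simp [Automaton.stepThen] at h
    · have h' : (B o).action q = none := Option.map_eq_none_iff.1 h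
      obtain ⟨c, hc, inv_halt⟩ := (hB o).halt q h'
      obtain ⟨d, hd, mul_eq⟩ := hU o
      exact ⟨c * d, mul_ne_zero hc hd, by
        simp only [Option.elim_some]; rw [inv_halt, smul_mul_assoc, mul_eq, smul_smul]⟩

end Automaton

section Programmable

variable {n : ℕ}

/-- `U` is applied by an automaton measuring only observables of `O` which satisfies the two
conditions, `Realizes` and `HaltsUniformly`, that are stable under composition of automata. -/
def Programmable (O : Family) (U : Op (Fin n)) : Prop :=
  ∃ A : Automaton n, A.UsesOnly O ∧ (∃ inv, A.Realizes U inv) ∧ A.HaltsUniformly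

theorem Programmable.simulable {O : Family} {U : Op (Fin n)} (h : Programmable O U) :
    Simulable O U := by
  obtain ⟨A, hO, ⟨inv, hinv⟩, hA⟩ := h
  exact ⟨A, hO, hinv.simulates hA⟩

theorem Programmable.mul {O : Family} {U V : Op (Fin n)} (hV : Programmable O V)
    (hU : Programmable O U) : Programmable O (V * U) := by
  obtain ⟨A, A_usesOnly, ⟨invA, A_realizes⟩, A_halts⟩ := hU
  obtain ⟨B, B_usesOnly, ⟨invB, B_realizes⟩, B_halts⟩ := hV
  exact ⟨A.seq B, A_usesOnly.seq B_usesOnly, ⟨_, A_realizes.seq B_realizes⟩, A_halts.seq B_halts⟩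

theorem Programmable.one (O : Family) : Programmable O (1 : Op (Fin n)) := by
  refine ⟨⟨Unit, inferInstance, (), fun _ => none⟩, ?_, ⟨fun _ => 1, rfl, ?_, ?_⟩, ?_⟩
  · intro q s next h
    simp at h
  · intro q s next h
    simp at h
  · intro q _
    exact ⟨1, one_ne_zero, by simp⟩
  · refine ⟨0, 1, one_pos, fun q e ψ => ?_⟩
    rw [Automaton.haltWeight_of_halting _ rfl, one_mul]

theorem Programmable.pow {O : Family} {U : Op (Fin n)} (hU : Programmable O U) (k : ℕ) :
    Programmable O (U ^ k) := by
  induction k with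
  | zero => exact Programmable.one O
  | succ k ih => exact ih.mul hU

theorem Programmable.smul {O : Family} {U : Op (Fin n)} (h : Programmable O U) {c : ℂ}
    (hc : c ≠ 0) : Programmable O (c • U) := by
  obtain ⟨A, hO, ⟨inv, hinv⟩, hA⟩ := h
  refine ⟨A, hO, ⟨inv, hinv.start, hinv.step, fun q hq => ?_⟩, hA⟩
  obtain ⟨d, hd, inv_halt⟩ := hinv.halt q hq
  exact ⟨d * c⁻¹, mul_ne_zero hd (inv_ne_zero hc), by
    rw [inv_halt, smul_smul, mul_assoc, inv_mul_cancel₀ hc, mul_one]⟩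

theorem Programmable.stepThen {O : Family} {U : Op (Fin n)} {s : Step n}
    {L V : (Fin s.arity → Bool) → Op (Fin n)}
    (hs : ∀ (e : Placement n) (k : Fin s.arity), (s.obs e k).MemFamily O)
    (hL : ∀ o, s.Implements o (L o)) (hV : ∀ o, Programmable O (V o))
    (hU : ∀ o, ∃ c : ℂ, c ≠ 0 ∧ V o * L o = c • U) : Programmable O U := by
  choose B B_usesOnly B_realizes B_halts using hV
  choose inv B_realizes using B_realizes
  exact ⟨Automaton.stepThen s B, Automaton.UsesOnly.stepThen hs B_usesOnly,
    ⟨_, Automaton.Realizes.stepThen hL B_realizes hU⟩, Automaton.HaltsUniformly.stepThen B_halts⟩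

theorem LocalOp.MemFamily.mono {W : Type} {O O' : Family} (one_subset : O.one ⊆ O'.one)
    (two_subset : O.two ⊆ O'.two) {M : LocalOp W} (h : M.MemFamily O) : M.MemFamily O' := by
  cases M with
  | one a M => exact one_subset h
  | two a b hab M => exact h.imp (@two_subset _) (@two_subset _)

theorem Programmable.mono {O O' : Family} (one_subset : O.one ⊆ O'.one)
    (two_subset : O.two ⊆ O'.two) {U : Op (Fin n)} (h : Programmable O U) :
    Programmable O' U := by
  obtain ⟨A, hO, hA⟩ := h
  exact ⟨A, fun q s next hq e k => (hO q s next hq e k).mono one_subset two_subset, hA⟩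

end Programmable

/-! ### Diagonal unitary matrices -/

section Diagonal

variable {ι : Type*} [Fintype ι] [DecidableEq ι]

theorem diagonal_mem_unitaryGroup_iff {d : ι → ℂ} :
    Matrix.diagonal d ∈ Matrix.unitaryGroup ι ℂ ↔ ∀ k, ‖d k‖ = 1 := by
  rw [Matrix.mem_unitaryGroup_iff, Matrix.star_eq_conjTranspose, Matrix.diagonal_conjTranspose,
    Matrix.diagonal_mul_diagonal, ← Matrix.diagonal_one, Matrix.diagonal_injective.eq_iff,
    funext_iff]
  refine forall_congr' fun k => ?_
  rw [Pi.star_apply, Complex.star_def, Complex.mul_conj, Complex.normSq_eq_norm_sq]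
  norm_cast
  exact pow_eq_one_iff_of_nonneg (norm_nonneg _) two_ne_zero

/-- The diagonal unitary matrix with prescribed entries on the unit circle. -/
def diagonalUnitary : (ι → Circle) →* Matrix.unitaryGroup ι ℂ where
  toFun d := ⟨Matrix.diagonal fun k => d k,
    diagonal_mem_unitaryGroup_iff.2 fun k => Circle.norm_coe (d k)⟩
  map_one' := Subtype.ext Matrix.diagonal_one
  map_mul' _ _ := Subtype.ext (Matrix.diagonal_mul_diagonal _ _).symm

theorem exists_eq_diagonalUnitary {D : Matrix.unitaryGroup ι ℂ} (hD : D.1.IsDiag) :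
    ∃ d, D = diagonalUnitary d := by
  have norm_eq_one : ∀ k, ‖D.1.diag k‖ = 1 := diagonal_mem_unitaryGroup_iff.1 <| by
    rw [hD.diagonal_diag]
    exact D.2
  exact ⟨fun k => ⟨D.1.diag k, mem_sphere_zero_iff_norm.2 (norm_eq_one k)⟩,
    Subtype.ext hD.diagonal_diag.symm⟩

end Diagonal

/-! ### The gates `H` and `T` -/

theorem invSqrtTwo_mul_self : ((Real.sqrt 2 : ℝ) : ℂ)⁻¹ * ((Real.sqrt 2 : ℝ) : ℂ)⁻¹ = 2⁻¹ := by
  rw [← mul_inv, ← Complex.ofReal_mul, Real.mul_self_sqrt (by norm_num)]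
  norm_num

/-- The eighth root of unity `e^{iπ/4}`. -/
def zeta8 : Circle := Circle.exp (Real.pi / 4)

theorem gateT_eq : gateT = Matrix.diagonal ![1, (zeta8 : ℂ)] := by
  rw [Matrix.diagonal_fin_two, gateT, zeta8, Circle.coe_exp, mul_comm Complex.I, mul_div_right_comm]
  push_cast
  rfl

theorem coe_zeta8 : (zeta8 : ℂ) = ((Real.sqrt 2 : ℝ) : ℂ)⁻¹ * (1 + Complex.I) := by
  have sqrt_two_div_two : ((Real.sqrt 2 / 2 : ℝ) : ℂ) = ((Real.sqrt 2 : ℝ) : ℂ)⁻¹ := by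
    rw [Real.sqrt_div_self', one_div, Complex.ofReal_inv]
  rw [zeta8, Circle.coe_exp, Complex.exp_mul_I, ← Complex.ofReal_cos, ← Complex.ofReal_sin,
    Real.cos_pi_div_four, Real.sin_pi_div_four, sqrt_two_div_two, mul_add, mul_one]

theorem star_zeta8 : star (zeta8 : ℂ) = ((Real.sqrt 2 : ℝ) : ℂ)⁻¹ * (1 - Complex.I) := by
  rw [coe_zeta8, star_mul', star_inv₀, star_add, star_one, Complex.star_def,
    Complex.conj_ofReal, Complex.conj_I, sub_eq_add_neg]

theorem zeta8_sq : (zeta8 : ℂ) ^ 2 = Complex.I := by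
  rw [coe_zeta8]
  linear_combination (1 + Complex.I) ^ 2 * invSqrtTwo_mul_self + 2⁻¹ * Complex.I_sq

theorem zeta8_pow_eight : zeta8 ^ 8 = 1 := by
  rw [← Circle.coe_inj, Circle.coe_pow, Circle.coe_one, show (8 : ℕ) = 2 * 4 from rfl, pow_mul,
    zeta8_sq, Complex.I_pow_four]

theorem isObservable_gateH : IsObservable gateH where
  isSelfAdjoint := by
    ext i j
    fin_cases i <;> fin_cases j <;> simp [gateH, Complex.conj_ofReal]
  mul_self := by
    rw [gateH, smul_mul_smul_comm, invSqrtTwo_mul_self]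
    ext i j
    fin_cases i <;> fin_cases j <;> norm_num

theorem gateH_mul_gateH_mul (M : Mat1) : gateH * (gateH * M) = M := by
  rw [← mul_assoc, isObservable_gateH.mul_self, one_mul]

theorem gateH_conjTranspose : gateHᴴ = gateH := isObservable_gateH.isSelfAdjoint.star_eq

/-- `H` as an element of the unitary group. -/
def unitaryH : Matrix.unitaryGroup (Fin 2) ℂ :=
  ⟨gateH, Matrix.mem_unitaryGroup_iff.2 (by
    rw [isObservable_gateH.isSelfAdjoint.star_eq, isObservable_gateH.mul_self])⟩

/-- `T` as an element of the unitary group. -/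
def unitaryT : Matrix.unitaryGroup (Fin 2) ℂ := diagonalUnitary ![1, zeta8]

theorem coe_unitaryT : unitaryT.1 = gateT := by
  rw [gateT_eq]
  refine congrArg Matrix.diagonal (funext fun i => ?_)
  fin_cases i <;> rfl

theorem unitaryT_eq_inv_pow : unitaryT = unitaryT⁻¹ ^ 7 := by
  rw [inv_pow, eq_inv_iff_mul_eq_one, ← pow_succ', unitaryT, ← map_pow, ← map_one diagonalUnitary]
  refine congrArg diagonalUnitary (funext fun i => ?_)
  fin_cases i
  · exact one_pow _
  · exact zeta8_pow_eight

theorem gateH_mul_pauliX_mul_gateH : gateH * pauliX * gateH = pauliZ := by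
  rw [gateH, smul_mul_assoc, smul_mul_smul_comm, invSqrtTwo_mul_self]
  ext i j
  fin_cases i <;> fin_cases j <;> norm_num [pauliX, pauliZ]

theorem gateH_mul_pauliZ_mul_gateH : gateH * pauliZ * gateH = pauliX := by
  simp only [← gateH_mul_pauliX_mul_gateH, mul_assoc, gateH_mul_gateH_mul,
    isObservable_gateH.mul_self, mul_one]

theorem gateT_mul_pauliX_mul : gateT * pauliX * gateTᴴ = diagXY := by
  rw [gateT_eq, Matrix.diagonal_conjTranspose]
  ext i j
  rw [Matrix.mul_diagonal, Matrix.diagonal_mul]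
  fin_cases i <;> fin_cases j
  · simp [pauliX, pauliY, diagXY]
  · simpa [pauliX, pauliY, diagXY, sub_eq_add_neg] using star_zeta8
  · simpa [pauliX, pauliY, diagXY] using coe_zeta8
  · simp [pauliX, pauliY, diagXY]

theorem gateT_mul_pauliZ_mul : gateT * pauliZ * gateTᴴ = pauliZ := by
  have commute : gateT * pauliZ = pauliZ * gateT := by
    rw [show pauliZ = Matrix.diagonal ![1, -1] by
      rw [Matrix.diagonal_fin_two]; rfl, gateT_eq]
    exact Matrix.commute_diagonal _ _
  have gateT_mul_conjTranspose : gateT * gateTᴴ = 1 := by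
    rw [← coe_unitaryT]
    exact Matrix.mem_unitaryGroup_iff.1 unitaryT.2
  rw [commute, mul_assoc, gateT_mul_conjTranspose, mul_one]

/-! ### Pauli operators up to a scalar -/

/-- The product of two Pauli operators, up to a scalar. -/
def pauliMul (p q : Bool × Bool) : Bool × Bool := (xor p.1 q.1, xor p.2 q.2)

theorem pauli_mul_pauli (p q : Bool × Bool) :
    ∃ c : ℂ, c ≠ 0 ∧ pauli p * pauli q = c • pauli (pauliMul p q) := by
  refine ⟨if p.2 && q.1 then -1 else 1, by split_ifs <;> norm_num, ?_⟩
  have hX := isObservable_pauliX.mul_self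
  have hZ := isObservable_pauliZ.mul_self
  have hZX : pauliZ * pauliX = -(pauliX * pauliZ) := anticommute_pauliZ_pauliX
  have hX_mul (M : Mat1) : pauliX * (pauliX * M) = M := by rw [← mul_assoc, hX, one_mul]
  have hZX_mul (M : Mat1) : pauliZ * (pauliX * M) = -(pauliX * (pauliZ * M)) := by
    rw [← mul_assoc, hZX, neg_mul, mul_assoc]
  obtain ⟨p1, p2⟩ := p
  obtain ⟨q1, q2⟩ := q
  cases p1 <;> cases p2 <;> cases q1 <;> cases q2 <;>
    simp [pauli, pauliMul, mul_assoc, hX, hZ, hZX, hX_mul, hZX_mul]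

theorem pauli_mul_self (p : Bool × Bool) : ∃ c : ℂ, c ≠ 0 ∧ pauli p * pauli p = c • 1 := by
  obtain ⟨c, hc, mul_eq⟩ := pauli_mul_pauli p p
  exact ⟨c, hc, by rw [mul_eq]; simp [pauliMul, pauli]⟩

theorem gateH_mul_pauli_mul_gateH (p : Bool × Bool) :
    ∃ c : ℂ, c ≠ 0 ∧ gateH * pauli p * gateH = c • pauli p.swap := by
  have hX := gateH_mul_pauliX_mul_gateH
  have hZ := gateH_mul_pauliZ_mul_gateH
  have hXZ : gateH * (pauliX * pauliZ) * gateH = -(pauliX * pauliZ) := by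
    calc gateH * (pauliX * pauliZ) * gateH
        = (gateH * pauliX * gateH) * (gateH * pauliZ * gateH) := by
          simp only [mul_assoc, gateH_mul_gateH_mul]
      _ = -(pauliX * pauliZ) := by rw [hX, hZ]; exact anticommute_pauliZ_pauliX
  refine ⟨if p.1 && p.2 then -1 else 1, by split_ifs <;> norm_num, ?_⟩
  obtain ⟨p1, p2⟩ := p
  cases p1 <;> cases p2 <;> simp [pauli, hX, hZ, isObservable_gateH.mul_self, hXZ]

theorem gateH_mul_pauli_mul_pauli_mul_gateH (p q : Bool × Bool) :
    ∃ c : ℂ, c ≠ 0 ∧ gateH * pauli p * (pauli q * gateH) = c • pauli (pauliMul p q).swap := by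
  obtain ⟨c, hc, mul_eq⟩ := pauli_mul_pauli p q
  obtain ⟨d, hd, conj_eq⟩ := gateH_mul_pauli_mul_gateH (pauliMul p q)
  refine ⟨c * d, mul_ne_zero hc hd, ?_⟩
  rw [← mul_assoc, mul_assoc gateH, mul_eq, mul_smul_comm, smul_mul_assoc, conj_eq, smul_smul]

theorem pauli_mul_gateH_mul_pauli (p q : Bool × Bool) :
    ∃ c : ℂ, c ≠ 0 ∧ pauli p * gateH * pauli q = c • (pauli (pauliMul p q.swap) * gateH) := by
  obtain ⟨c, hc, mul_eq⟩ := pauli_mul_pauli p q.swap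
  obtain ⟨d, hd, conj_eq⟩ := gateH_mul_pauli_mul_gateH q
  refine ⟨d * c, mul_ne_zero hd hc, ?_⟩
  calc pauli p * gateH * pauli q = pauli p * (gateH * pauli q * gateH) * gateH := by
        simp only [mul_assoc, isObservable_gateH.mul_self, mul_one]
    _ = (d * c) • (pauli (pauliMul p q.swap) * gateH) := by
        rw [conj_eq, mul_smul_comm, mul_eq, smul_smul, smul_mul_assoc]

/-! ### Gates programmed with the observables `Z, X, (X+Y)/√2, Z ⊗ X` -/

section Gates

variable {n : ℕ}

theorem transfer_obs_memFamily {O : Family} {i : Fin n} {U V : Matrix.unitaryGroup (Fin 2) ℂ}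
    (aux_mem : V.1 * pauliX * V.1ᴴ ∈ O.one)
    (pair_mem : (U.1ᴴ * pauliZ * U.1) ⊗ₖ (V.1 * pauliZ * V.1ᴴ) ∈ O.two ∨
      (V.1 * pauliZ * V.1ᴴ) ⊗ₖ (U.1ᴴ * pauliZ * U.1) ∈ O.two)
    (data_mem : U.1ᴴ * pauliX * U.1 ∈ O.one) (e : Placement n)
    (k : Fin (Step.transfer i U V).arity) : ((Step.transfer i U V).obs e k).MemFamily O := by
  change Fin 3 at k
  fin_cases k
  · exact aux_mem
  · refine pair_mem.imp id fun h => ?_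
    convert h using 1
    ext ⟨a, b⟩ ⟨c, d⟩
    exact mul_comm _ _
  · exact data_mem

theorem cnot_obs_memFamily {i j : Fin n} (hij : i ≠ j) (e : Placement n)
    (k : Fin (Step.cnot i j hij).arity) :
    ((Step.cnot i j hij).obs e k).MemFamily obsFamily₂ := by
  change Fin 4 at k
  fin_cases k
  · exact Or.inl rfl
  · exact Or.inl rfl
  · exact Or.inl rfl
  · exact Or.inr (Or.inl rfl)

theorem transfer_H_one_memFamily (i : Fin n) (e : Placement n)
    (k : Fin (Step.transfer i unitaryH 1).arity) :
    ((Step.transfer i unitaryH 1).obs e k).MemFamily obsFamily₂ := by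
  apply transfer_obs_memFamily <;>
    simp [unitaryH, gateH_conjTranspose, gateH_mul_pauliX_mul_gateH, gateH_mul_pauliZ_mul_gateH,
      obsFamily₂]

theorem transfer_one_H_memFamily (i : Fin n) (e : Placement n)
    (k : Fin (Step.transfer i 1 unitaryH).arity) :
    ((Step.transfer i 1 unitaryH).obs e k).MemFamily obsFamily₂ := by
  apply transfer_obs_memFamily <;>
    simp [unitaryH, gateH_conjTranspose, gateH_mul_pauliX_mul_gateH, gateH_mul_pauliZ_mul_gateH,
      obsFamily₂]

theorem transfer_T_H_memFamily (i : Fin n) (e : Placement n)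
    (k : Fin (Step.transfer i unitaryT⁻¹ unitaryH).arity) :
    ((Step.transfer i unitaryT⁻¹ unitaryH).obs e k).MemFamily obsFamily₂ := by
  apply transfer_obs_memFamily <;>
    simp [coe_unitaryT, Matrix.star_eq_conjTranspose, unitaryH, gateH_conjTranspose,
      gateH_mul_pauliX_mul_gateH, gateH_mul_pauliZ_mul_gateH, gateT_mul_pauliX_mul,
      gateT_mul_pauliZ_mul, obsFamily₂]

/-- The automaton that applies the Pauli operator `p` to the `i`-th qubit. It alternates transfers
with `H` before and transfers with `H` after the transfer, which both only need `Z ⊗ X` as a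
two-qubit observable, until the accumulated errors amount to `p`. The state `(b, q)` records that
`pauli q`, preceded by `H` when `b` holds, remains to be undone. -/
def pauliLoop (i : Fin n) (p : Bool × Bool) : Automaton n where
  State := Bool × (Bool × Bool)
  finite := inferInstance
  start := (false, p)
  action
    | (false, q) => if q = (false, false) then none else
        some ⟨.transfer i unitaryH 1, fun o => (true, pauliMul (transferError o) q.swap)⟩
    | (true, q) =>
        some ⟨.transfer i 1 unitaryH, fun o => (false, (pauliMul (transferError o) q).swap)⟩

theorem pauliLoop_action_false (i : Fin n) (p : Bool × Bool) {q : Bool × Bool}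
    (hq : q ≠ (false, false)) : (pauliLoop i p).action (false, q) =
      some ⟨.transfer i unitaryH 1, fun o => (true, pauliMul (transferError o) q.swap)⟩ :=
  if_neg hq

theorem pauliLoop_action_false_none (i : Fin n) (p : Bool × Bool) :
    (pauliLoop i p).action (false, (false, false)) = none := by
  simp [pauliLoop]

theorem pauliLoop_usesOnly (i : Fin n) (p : Bool × Bool) :
    (pauliLoop i p).UsesOnly obsFamily₂ := by
  rintro ⟨_ | _, q⟩ s next h
  · rcases eq_or_ne q (false, false) with rfl | hq
    · cases h
    · rw [pauliLoop_action_false i p hq] at h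
      cases h
      exact transfer_H_one_memFamily i
  · cases h
    exact transfer_one_H_memFamily i

/-- One of the four equiprobable errors of the second transfer is the one that ends the loop. -/
theorem weight_le_haltWeight_pauliLoop_true (i : Fin n) (p q : Bool × Bool) (e : Placement n)
    (ψ : Ket (Option (Fin n))) :
    4⁻¹ * weight ψ ≤ (pauliLoop i p).haltWeight 1 (true, q) e ψ := by
  rw [(pauliLoop i p).haltWeight_succ_of_step (q := (true, q)) (s := .transfer i 1 unitaryH) rfl,
    inv_mul_eq_div, ← Step.sum_weight_kraus_transfer e i 1 unitaryH q ψ]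
  refine le_trans (Finset.sum_le_sum fun o ho => ?_)
    (Finset.sum_le_sum_of_subset_of_nonneg (Finset.filter_subset _ _)
      fun o _ _ => Automaton.haltWeight_nonneg _ _ _ _ _)
  refine (Automaton.haltWeight_of_halting _ ?_ _ _ _).ge
  rw [(Finset.mem_filter.1 ho).2, show (pauliMul q q).swap = (false, false) by simp [pauliMul]]
  exact pauliLoop_action_false_none i p

theorem pauliLoop_haltsUniformly (i : Fin n) (p : Bool × Bool) :
    (pauliLoop i p).HaltsUniformly := by
  have of_true := weight_le_haltWeight_pauliLoop_true i p
  refine ⟨2, 4⁻¹, by norm_num, ?_⟩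
  rintro ⟨_ | _, q⟩ e ψ
  · rcases eq_or_ne q (false, false) with rfl | hq
    · rw [Automaton.haltWeight_of_halting _ (pauliLoop_action_false_none i p)]
      linarith [weight_nonneg ψ]
    · rw [Automaton.haltWeight_succ_of_step _ (pauliLoop_action_false i p hq),
        ← Step.sum_weight_kraus e _ ψ, Finset.mul_sum]
      exact Finset.sum_le_sum fun o _ => of_true _ _ _
  · exact (of_true q e ψ).trans ((pauliLoop i p).haltWeight_mono _ e ψ one_le_two)

theorem Step.Implements.exists_mul_eq {s : Step n} {o : Fin s.arity → Bool} {i : Fin n}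
    {L M N R : Mat1} (hL : s.Implements o (onQubit i L))
    (h : ∃ c : ℂ, c ≠ 0 ∧ L * M = c • N) (d : ℂ) :
    ∃ L', s.Implements o L' ∧ d • onQubit i (N * R) = L' * d • onQubit i (M * R) := by
  obtain ⟨c, hc, mul_eq⟩ := h
  refine ⟨c⁻¹ • onQubit i L, hL.smul (inv_ne_zero hc), ?_⟩
  rw [mul_smul_comm, smul_mul_assoc, ← map_mul, ← mul_assoc, mul_eq, smul_mul_assoc, map_smul,
    inv_smul_smul₀ hc]

theorem pauliLoop_realizes (i : Fin n) (p : Bool × Bool) {c : ℂ} (hc : c ≠ 0)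
    (h : pauli p * pauli p = c • 1) :
    (pauliLoop i p).Realizes (onQubit i (pauli p))
      fun q => c⁻¹ • onQubit i (pauli q.2 * (if q.1 then gateH else 1) * pauli p) where
  start := by simp [pauliLoop, h, hc]
  step := by
    rintro ⟨_ | _, q⟩ s next hq o
    · rcases eq_or_ne q (false, false) with rfl | hq'
      · cases hq
      · rw [pauliLoop_action_false i p hq'] at hq
        cases hq
        have implements := Step.implements_transfer i unitaryH 1 o
        rw [OneMemClass.coe_one, one_mul] at implements
        refine implements.exists_mul_eq ?_ _
        simpa [unitaryH] using pauli_mul_gateH_mul_pauli (transferError o) q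
    · cases hq
      have implements := Step.implements_transfer i 1 unitaryH o
      rw [OneMemClass.coe_one, mul_one] at implements
      refine implements.exists_mul_eq ?_ _
      simpa [unitaryH] using gateH_mul_pauli_mul_pauli_mul_gateH (transferError o) q
  halt := by
    rintro ⟨_ | _, q⟩ hq
    · rcases eq_or_ne q (false, false) with rfl | hq'
      · exact ⟨c⁻¹, inv_ne_zero hc, by simp [pauli]⟩
      · rw [pauliLoop_action_false i p hq'] at hq
        cases hq
    · cases hq

theorem programmable_pauli (i : Fin n) (p : Bool × Bool) :
    Programmable obsFamily₂ (onQubit i (pauli p)) := by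
  obtain ⟨c, hc, pauli_sq⟩ := pauli_mul_self p
  exact ⟨pauliLoop i p, pauliLoop_usesOnly i p, ⟨_, pauliLoop_realizes i p hc pauli_sq⟩,
    pauliLoop_haltsUniformly i p⟩

theorem programmable_transfer {O : Family} (i : Fin n) (U V : Matrix.unitaryGroup (Fin 2) ℂ)
    (hO : ∀ e k, ((Step.transfer i U V).obs e k).MemFamily O)
    (hV : ∀ p, Programmable O (onQubit i (V.1 * pauli p * V.1ᴴ))) :
    Programmable O (onQubit i (V.1 * U.1)) := by
  refine Programmable.stepThen hO (Step.implements_transfer i U V)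
    (fun o => hV (transferError o)) fun o => ?_
  obtain ⟨c, hc, pauli_sq⟩ := pauli_mul_self (transferError o)
  refine ⟨c, hc, ?_⟩
  rw [← map_mul, ← map_smul]
  congr 1
  calc V.1 * pauli (transferError o) * V.1ᴴ * (V.1 * pauli (transferError o) * U.1)
      = V.1 * pauli (transferError o) * (V.1ᴴ * V.1) * pauli (transferError o) * U.1 := by
        simp only [mul_assoc]
    _ = V.1 * (pauli (transferError o) * pauli (transferError o)) * U.1 := by
        rw [← Matrix.star_eq_conjTranspose, Matrix.mem_unitaryGroup_iff'.1 V.2, mul_one,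
          mul_assoc V.1]
    _ = c • (V.1 * U.1) := by rw [pauli_sq, mul_smul_comm, mul_one, smul_mul_assoc]

theorem programmable_gateH (i : Fin n) : Programmable obsFamily₂ (onQubit i gateH) := by
  have transfer := programmable_transfer i unitaryH 1 (transfer_H_one_memFamily i) fun p => by
    simpa using programmable_pauli i p
  simpa [unitaryH] using transfer

/-- The transfer applies `H T†`. -/
theorem programmable_inv_gateT (i : Fin n) :
    Programmable obsFamily₂ (onQubit i (unitaryT⁻¹).1) := by
  have correction (p : Bool × Bool) :
      Programmable obsFamily₂ (onQubit i (unitaryH.1 * pauli p * unitaryH.1ᴴ)) := by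
    obtain ⟨c, hc, conj_eq⟩ := gateH_mul_pauli_mul_gateH p
    rw [unitaryH, gateH_conjTranspose, conj_eq, map_smul]
    exact (programmable_pauli i p.swap).smul hc
  have H_mul_transfer := (programmable_gateH i).mul
    (programmable_transfer i unitaryT⁻¹ unitaryH (transfer_T_H_memFamily i) correction)
  rwa [← map_mul, unitaryH, gateH_mul_gateH_mul] at H_mul_transfer

theorem programmable_gateT (i : Fin n) : Programmable obsFamily₂ (onQubit i gateT) := by
  rw [← coe_unitaryT, unitaryT_eq_inv_pow, SubmonoidClass.coe_pow, map_pow]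
  exact (programmable_inv_gateT i).pow 7

theorem pauli_correction_cnotOp {i j : Fin n} (hij : i ≠ j) (p q : Bool × Bool) :
    ∃ c : ℂ, c ≠ 0 ∧ onQubit j (pauli q) * onQubit i (pauli p) *
      (onQubit i (pauli p) * onQubit j (pauli q) * cnotOp hij) = c • cnotOp hij := by
  obtain ⟨c, hc, p_sq⟩ := pauli_mul_self p
  obtain ⟨d, hd, q_sq⟩ := pauli_mul_self q
  refine ⟨c * d, mul_ne_zero hc hd, ?_⟩
  calc onQubit j (pauli q) * onQubit i (pauli p) *
        (onQubit i (pauli p) * onQubit j (pauli q) * cnotOp hij)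
      = onQubit j (pauli q) * (onQubit i (pauli p) * onQubit i (pauli p)) *
          onQubit j (pauli q) * cnotOp hij := by
        simp only [mul_assoc]
    _ = c • (onQubit j (pauli q) * onQubit j (pauli q)) * cnotOp hij := by
        rw [← map_mul, p_sq, map_smul, map_one, mul_smul_comm, mul_one, smul_mul_assoc]
    _ = (c * d) • cnotOp hij := by
        rw [← map_mul, q_sq, map_smul, map_one, smul_smul, smul_mul_assoc, one_mul]

theorem programmable_cnotOp {i j : Fin n} (hij : i ≠ j) :
    Programmable obsFamily₂ (cnotOp hij) :=
  Programmable.stepThen (cnot_obs_memFamily hij) (Step.implements_cnot hij)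
    (fun o : Fin 4 → Bool => (programmable_pauli j (xor (o 1) (o 3), false)).mul
      (programmable_pauli i (false, xor (o 0) (o 2))))
    fun _ => pauli_correction_cnotOp hij _ _

theorem obsFamily₂_one_subset : obsFamily₂.one ⊆ obsFamily₁.one := subset_rfl

theorem obsFamily₂_two_subset : obsFamily₂.two ⊆ obsFamily₁.two := by
  rintro M rfl
  exact Or.inr rfl

theorem programmable_onQubit_allObs (i : Fin n) (U : Matrix.unitaryGroup (Fin 2) ℂ) :
    Programmable allObs (onQubit i U.1) := by
  have transfer := programmable_transfer (O := allObs) i U 1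
    (transfer_obs_memFamily trivial (Or.inl trivial) trivial) fun p => by
      simpa using (programmable_pauli i p).mono (Set.subset_univ _) (Set.subset_univ _)
  simpa using transfer

theorem programmable_circuit {O G : Family} (c : Circuit n) (hc : c.Over G)
    (programmable_one : ∀ M ∈ G.one, ∀ i : Fin n, Programmable O (onQubit i M))
    (two_subset : G.two ⊆ {gateCNot})
    (programmable_cnot : ∀ (i j : Fin n) (hij : i ≠ j), Programmable O (cnotOp hij)) :
    Programmable O c.toOp := by
  induction c with
  | nil => exact Programmable.one O
  | cons g c ih =>
    have programmable_gate : Programmable O g.toOp := by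
      have hg := hc g List.mem_cons_self
      cases g with
      | one a M => exact programmable_one M hg a
      | two a b hab M =>
        rcases hg with hM | hM
        · obtain rfl := two_subset hM
          exact programmable_cnot a b hab
        · rw [toOp_two_swap, two_subset hM]
          exact programmable_cnot b a hab.symm
    have programmable_cons :=
      (ih fun g' hg' => hc g' (List.mem_cons_of_mem _ hg')).mul programmable_gate
    simpa [Circuit.toOp] using programmable_cons

theorem programmable_gatesHT (c : Circuit n) (hc : c.Over gatesHT) :
    Programmable obsFamily₂ c.toOp := by
  refine programmable_circuit c hc ?_ subset_rfl fun _ _ => programmable_cnotOp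
  rintro M (rfl | rfl) i
  · exact programmable_gateH i
  · exact programmable_gateT i

theorem programmable_gatesHHT (c : Circuit n) (hc : c.Over gatesHHT) :
    Programmable obsFamily₂ c.toOp := by
  refine programmable_circuit c hc ?_ subset_rfl fun _ _ => programmable_cnotOp
  rintro M (rfl | rfl) i
  · exact programmable_gateH i
  · rw [map_mul]
    exact (programmable_gateH i).mul (programmable_gateT i)

end Gates

/-! ### Complex reflections -/

section Reflections

variable {ι : Type*} [Fintype ι] [DecidableEq ι]

theorem star_mulVec_dotProduct_mulVec (g : Matrix.unitaryGroup ι ℂ) (v w : ι → ℂ) :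
    star (g.1 *ᵥ v) ⬝ᵥ (g.1 *ᵥ w) = star v ⬝ᵥ w := by
  have star_mul_self : g.1ᴴ * g.1 = 1 := Unitary.coe_star_mul_self g
  rw [Matrix.star_mulVec, ← Matrix.dotProduct_mulVec, Matrix.mulVec_mulVec, star_mul_self,
    Matrix.one_mulVec]

/-- Complex reflections: matrices that differ from the identity by a multiple of the projection
onto a line. -/
def IsReflection (R : Matrix ι ι ℂ) : Prop :=
  ∃ (b : ℂ) (u : ι → ℂ), R = 1 + b • Matrix.vecMulVec u (star u)

theorem one_add_smul_vecMulVec_mem_unitaryGroup {b : ℂ} {u : ι → ℂ}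
    (h : b + star b + b * star b * (star u ⬝ᵥ u) = 0) :
    1 + b • Matrix.vecMulVec u (star u) ∈ Matrix.unitaryGroup ι ℂ := by
  rw [Matrix.mem_unitaryGroup_iff, Matrix.star_eq_conjTranspose, Matrix.conjTranspose_add,
    Matrix.conjTranspose_one, Matrix.conjTranspose_smul, Matrix.conjTranspose_vecMulVec, star_star,
    mul_add, mul_one, add_mul, one_mul, smul_mul_smul_comm, Matrix.vecMulVec_mul_vecMulVec,
    Matrix.vecMulVec_smul, smul_smul, add_assoc, ← add_smul, ← add_smul, ← add_assoc, h, zero_smul,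
    add_zero]

theorem one_add_smul_vecMulVec_mulVec (b : ℂ) (u x : ι → ℂ) :
    (1 + b • Matrix.vecMulVec u (star u)) *ᵥ x = x + (b * (star u ⬝ᵥ x)) • u := by
  rw [Matrix.add_mulVec, Matrix.one_mulVec, Matrix.smul_mulVec, Matrix.vecMulVec_mulVec,
    op_smul_eq_smul, smul_smul]

open scoped ComplexOrder in
/-- The reflection is along `w - v`; its multiplier is chosen so that `w` is moved to `v`. -/
theorem exists_isReflection_mulVec_eq {v w : ι → ℂ} (hv : star v ⬝ᵥ v = 1)
    (hw : star w ⬝ᵥ w = 1) :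
    ∃ R : Matrix.unitaryGroup ι ℂ, IsReflection R.1 ∧ R.1 *ᵥ w = v ∧
      ∀ x, star v ⬝ᵥ x = star w ⬝ᵥ x → R.1 *ᵥ x = x := by
  rcases eq_or_ne w v with rfl | hne
  · exact ⟨1, ⟨0, 0, by simp⟩, Matrix.one_mulVec w, fun x _ => Matrix.one_mulVec x⟩
  set u := w - v with hu
  set a := star u ⬝ᵥ w with ha
  have star_u_dotProduct (x : ι → ℂ) : star u ⬝ᵥ x = star w ⬝ᵥ x - star v ⬝ᵥ x := by
    rw [hu, star_sub, sub_dotProduct]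
  have star_a : star a = -(star u ⬝ᵥ v) := by
    rw [ha, hu, star_sub, sub_dotProduct, sub_dotProduct, hv, hw, neg_sub, star_sub, star_one,
      Matrix.star_dotProduct, star_star]
  have norm_sq_u : star u ⬝ᵥ u = a + star a := by
    rw [star_a, ← sub_eq_add_neg, ha, ← dotProduct_sub]
  have a_ne : a ≠ 0 := fun h0 => sub_ne_zero.2 hne <| dotProduct_star_self_eq_zero.1 <| by
    rw [← hu, norm_sq_u, h0, star_zero, add_zero]
  have star_a_ne : star a ≠ 0 := star_ne_zero.2 a_ne
  refine ⟨⟨1 + (-a⁻¹) • Matrix.vecMulVec u (star u), one_add_smul_vecMulVec_mem_unitaryGroup ?_⟩,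
    ⟨_, _, rfl⟩, ?_, fun x hx => ?_⟩
  · rw [norm_sq_u, star_neg, star_inv₀]
    field_simp
    ring
  · rw [one_add_smul_vecMulVec_mulVec, ← ha, neg_mul, inv_mul_cancel₀ a_ne, neg_one_smul, hu]
    abel
  · rw [one_add_smul_vecMulVec_mulVec, star_u_dotProduct, hx, sub_self, mul_zero, zero_smul,
      add_zero]

/-- Moving the basis vectors back one at a time. -/
theorem eq_top_of_isReflection_mem {G : Subgroup (Matrix.unitaryGroup ι ℂ)}
    (isReflection_mem : ∀ R : Matrix.unitaryGroup ι ℂ, IsReflection R.1 → R ∈ G) : G = ⊤ := by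
  have mem_of_fixed_off (s : Finset ι) : ∀ U : Matrix.unitaryGroup ι ℂ,
      (∀ i ∉ s, U.1 *ᵥ Pi.single i 1 = Pi.single i 1) → U ∈ G := by
    induction s using Finset.induction_on with
    | empty =>
      intro U fixed
      have U_eq_one : U = 1 := Subtype.ext <| Matrix.ext_of_mulVec_single fun i => by
        rw [fixed i (Finset.notMem_empty i), OneMemClass.coe_one, Matrix.one_mulVec]
      exact U_eq_one ▸ one_mem G
    | insert k s hk ih =>
      intro U fixed
      have single_k : star (Pi.single k 1 : ι → ℂ) ⬝ᵥ Pi.single k 1 = 1 := by simp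
      obtain ⟨R, hR, R_mulVec, R_fixes⟩ := exists_isReflection_mulVec_eq
        (w := U.1 *ᵥ Pi.single k 1) single_k
        ((star_mulVec_dotProduct_mulVec U _ _).trans single_k)
      refine (Subgroup.mul_mem_cancel_left G (isReflection_mem R hR)).1 (ih (R * U) fun i hi => ?_)
      rw [MulMemClass.coe_mul, ← Matrix.mulVec_mulVec]
      rcases eq_or_ne i k with rfl | hik
      · exact R_mulVec
      · have U_fixes : U.1 *ᵥ Pi.single i 1 = Pi.single i 1 := fixed i (by simp [hik, hi])
        rw [U_fixes]
        refine R_fixes _ ?_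
        rw [← star_mulVec_dotProduct_mulVec U, U_fixes]
  exact Subgroup.eq_top_iff' G |>.2 fun U =>
    mem_of_fixed_off Finset.univ U fun i hi => absurd (Finset.mem_univ i) hi

/-- A reflection along `u` is conjugated by `g` to the reflection along `g u`, which is diagonal if
`g u` is a multiple of a basis vector. -/
theorem mem_of_isReflection {G : Subgroup (Matrix.unitaryGroup ι ℂ)}
    (diagonal_mem : ∀ d, diagonalUnitary d ∈ G)
    (exists_mulVec_eq_single : ∀ v : ι → ℂ, ∃ g ∈ G, ∃ k c, g.1 *ᵥ v = Pi.single k c)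
    {R : Matrix.unitaryGroup ι ℂ} (hR : IsReflection R.1) : R ∈ G := by
  obtain ⟨b, u, hR⟩ := hR
  obtain ⟨g, hg, k, c, hgu⟩ := exists_mulVec_eq_single u
  have conj_eq : (g * R * g⁻¹).1 =
      1 + b • Matrix.vecMulVec (Pi.single k c) (star (Pi.single k c)) := by
    rw [← hgu, Matrix.star_mulVec, ← Matrix.vecMulVec_mul, ← Matrix.mul_vecMulVec,
      MulMemClass.coe_mul, MulMemClass.coe_mul, hR, mul_add, add_mul, mul_one, mul_smul_comm,
      smul_mul_assoc]
    congr 1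
    exact Unitary.coe_mul_star_self g
  have conj_isDiag : (g * R * g⁻¹).1.IsDiag := by
    rw [conj_eq]
    refine Matrix.isDiag_one.add (Matrix.IsDiag.smul b fun i j hij => ?_)
    rcases eq_or_ne i k with rfl | hik
    · simp [Matrix.vecMulVec_apply, Pi.single_eq_of_ne hij.symm]
    · simp [Matrix.vecMulVec_apply, Pi.single_eq_of_ne hik]
  obtain ⟨d, conj_eq_diagonal⟩ := exists_eq_diagonalUnitary conj_isDiag
  have conj_mem : g * R * g⁻¹ ∈ G := conj_eq_diagonal ▸ diagonal_mem d
  simpa [mul_assoc] using mul_mem (mul_mem (inv_mem hg) conj_mem) hg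

end Reflections

/-! ### Walsh functions and diagonal operators -/

section Walsh

variable {ι : Type*}

/-- The sign `(-1)^t` of a bit. -/
def bitSign (t : Fin 2) : ℝ := if t = 0 then 1 else -1

theorem bitSign_add (s t : Fin 2) : bitSign (s + t) = bitSign s * bitSign t := by
  fin_cases s <;> fin_cases t <;> simp [bitSign]

theorem one_add_bitSign_mul_bitSign (s t : Fin 2) :
    1 + bitSign s * bitSign t = if s = t then 2 else 0 := by
  fin_cases s <;> fin_cases t <;> norm_num [bitSign]

/-- The Walsh functions, which are the characters of the group of bit strings. -/
def walsh (S : Finset ι) (x : ι → Fin 2) : ℝ := ∏ i ∈ S, bitSign (x i)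

theorem walsh_cons [DecidableEq ι] {S : Finset ι} {i j : ι} (hi : i ∉ S) (hj : j ∈ S)
    (x : ι → Fin 2) :
    walsh (S.cons i hi) x = walsh S (Function.update x j (x i + x j)) := by
  rw [walsh, walsh, Finset.prod_cons, ← Finset.mul_prod_erase _ _ hj,
    ← Finset.mul_prod_erase _ _ hj, Function.update_self, bitSign_add, mul_assoc]
  congr 2
  exact Finset.prod_congr rfl fun k hk => by
    rw [Function.update_of_ne (Finset.ne_of_mem_erase hk)]

theorem sum_walsh_mul_walsh [Fintype ι] (x y : ι → Fin 2) :
    ∑ S, walsh S x * walsh S y = if x = y then 2 ^ Fintype.card ι else 0 := by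
  have sum_eq_prod : ∑ S, walsh S x * walsh S y = ∏ i, (1 + bitSign (x i) * bitSign (y i)) := by
    simp only [walsh, ← Finset.prod_mul_distrib, Finset.prod_one_add, Finset.powerset_univ]
  simp only [sum_eq_prod, one_add_bitSign_mul_bitSign]
  split_ifs with hxy
  · simp [hxy]
  · obtain ⟨i, hi⟩ := Function.ne_iff.1 hxy
    exact Finset.prod_eq_zero (Finset.mem_univ i) (if_neg hi)

theorem span_walsh [Finite ι] : Submodule.span ℝ (Set.range (walsh (ι := ι))) = ⊤ := by
  classical
  have := Fintype.ofFinite ι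
  refine eq_top_iff.2 fun f _ => ?_
  have expansion : f = (2 ^ Fintype.card ι : ℝ)⁻¹ • ∑ y, f y • ∑ S, walsh S y • walsh S := by
    funext x
    simp [sum_walsh_mul_walsh, Finset.sum_apply, mul_comm (f x)]
  rw [expansion]
  exact Submodule.smul_mem _ _ <| Submodule.sum_mem _ fun y _ => Submodule.smul_mem _ _ <|
    Submodule.sum_mem _ fun S _ => Submodule.smul_mem _ _ <| Submodule.subset_span ⟨S, rfl⟩

end Walsh

section Diagonal

variable {W : Type} [Fintype W] [DecidableEq W]

/-- A one-qubit unitary placed on the qubit `a` of a register. -/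
def unitaryOnQubit (a : W) :
    Matrix.unitaryGroup (Fin 2) ℂ →* Matrix.unitaryGroup (W → Fin 2) ℂ where
  toFun U := ⟨onQubit a U.1, onQubit_mem_unitary a U.2⟩
  map_one' := Subtype.ext (map_one (onQubit a))
  map_mul' U V := Subtype.ext (map_mul (onQubit a) U.1 V.1)

/-- The controlled-not as an element of the unitary group of a register. -/
def cnotUnitary {a b : W} (hab : a ≠ b) : Matrix.unitaryGroup (W → Fin 2) ℂ :=
  ⟨cnotOp hab, cnotOp_mem_unitary hab⟩

theorem unitaryOnQubit_diagonalUnitary (a : W) (d : Fin 2 → Circle) :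
    unitaryOnQubit a (diagonalUnitary d) = diagonalUnitary fun x => d (x a) :=
  Subtype.ext (onQubit_diagonal a _)

theorem cnotUnitary_mul_diagonalUnitary_mul_cnotUnitary {a b : W} (hab : a ≠ b)
    (d : (W → Fin 2) → Circle) :
    cnotUnitary hab * diagonalUnitary d * cnotUnitary hab =
      diagonalUnitary fun x => d (Function.update x b (x a + x b)) :=
  Subtype.ext (cnotOp_mul_diagonal_mul_cnotOp hab _)

/-- The functions `f` such that `G` contains the diagonal matrix with the phases `e^{itf}` for every
real `t`. -/
def phaseSpace {ι : Type*} [Fintype ι] [DecidableEq ι] (G : Subgroup (Matrix.unitaryGroup ι ℂ)) :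
    Submodule ℝ (ι → ℝ) where
  carrier := {f | ∀ t : ℝ, diagonalUnitary (fun x => Circle.exp (t * f x)) ∈ G}
  zero_mem' t := by
    simp only [Pi.zero_apply, mul_zero, Circle.exp_zero]
    change diagonalUnitary 1 ∈ G
    rw [map_one]
    exact one_mem G
  add_mem' {f g} hf hg t := by
    simp only [Pi.add_apply, mul_add, Circle.exp_add]
    change diagonalUnitary (_ * _) ∈ G
    rw [map_mul]
    exact mul_mem (hf t) (hg t)
  smul_mem' c f hf t := by
    simpa only [Pi.smul_apply, smul_eq_mul, ← mul_assoc] using hf (t * c)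

variable {G : Subgroup (Matrix.unitaryGroup (W → Fin 2) ℂ)}

/-- Conjugation by a controlled-not adds its control to the parity defining a Walsh function of its
target. -/
theorem walsh_mem_phaseSpace (phase_mem : ∀ c : Circle, diagonalUnitary (fun _ => c) ∈ G)
    (onQubit_mem : ∀ i d, unitaryOnQubit i (diagonalUnitary d) ∈ G)
    (cnot_mem : ∀ (i j : W) (hij : i ≠ j), cnotUnitary hij ∈ G) (S : Finset W) :
    walsh S ∈ phaseSpace G := by
  rcases S.eq_empty_or_nonempty with rfl | hS
  · intro t
    simpa only [walsh, Finset.prod_empty] using phase_mem (Circle.exp (t * 1))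
  induction hS using Finset.Nonempty.cons_induction with
  | singleton i =>
    intro t
    simpa only [walsh, Finset.prod_singleton, unitaryOnQubit_diagonalUnitary] using
      onQubit_mem i fun s => Circle.exp (t * bitSign s)
  | cons i S hi hS ih =>
    obtain ⟨j, hj⟩ := hS
    have hij : i ≠ j := fun h => hi (h ▸ hj)
    intro t
    simpa only [walsh_cons hi hj, cnotUnitary_mul_diagonalUnitary_mul_cnotUnitary] using
      mul_mem (mul_mem (cnot_mem i j hij) (ih t)) (cnot_mem i j hij)

theorem diagonalUnitary_mem (phase_mem : ∀ c : Circle, diagonalUnitary (fun _ => c) ∈ G)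
    (onQubit_mem : ∀ i d, unitaryOnQubit i (diagonalUnitary d) ∈ G)
    (cnot_mem : ∀ (i j : W) (hij : i ≠ j), cnotUnitary hij ∈ G) (d : (W → Fin 2) → Circle) :
    diagonalUnitary d ∈ G := by
  have phaseSpace_eq_top : phaseSpace G = ⊤ := top_le_iff.1 <| span_walsh.symm.trans_le <|
    Submodule.span_le.2 <| Set.range_subset_iff.2 <|
      walsh_mem_phaseSpace phase_mem onQubit_mem cnot_mem
  have arg_mem : (fun x => Complex.arg (d x)) ∈ phaseSpace G :=
    phaseSpace_eq_top ▸ Submodule.mem_top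
  simpa only [one_mul, Circle.exp_arg] using arg_mem 1

end Diagonal

/-! ### Generation of the unitary group of a register -/

theorem exists_circle_mul_eq_norm (z : ℂ) : ∃ c : Circle, c * z = ‖z‖ := by
  obtain ⟨c, norm_c, hc⟩ := Complex.exists_norm_eq_mul_self z
  exact ⟨⟨c, mem_sphere_zero_iff_norm.2 norm_c⟩, hc.symm⟩

/-- The phases `p` make the two amplitudes orthogonal in the complex plane, so that their sum and
their difference have the same absolute value. -/
theorem exists_phases_mul_add_eq_mul_sub (a b : ℂ) : ∃ p d : Fin 2 → Circle,
    d 0 * (p 0 * a + p 1 * b) = d 1 * (p 0 * a - p 1 * b) := by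
  obtain ⟨u, hu⟩ := exists_circle_mul_eq_norm a
  obtain ⟨w, hw⟩ := exists_circle_mul_eq_norm (-Complex.I * b)
  obtain ⟨e, he⟩ := exists_circle_mul_eq_norm (‖a‖ + Complex.I * ‖b‖)
  have w_mul_b : w * b = Complex.I * ‖b‖ := by
    rw [norm_mul, norm_neg, Complex.norm_I, one_mul] at hw
    linear_combination Complex.I * hw + w * b * Complex.I_mul_I
  have conj_he := congrArg (starRingEnd ℂ) he
  simp only [map_mul, map_add, Complex.conj_ofReal, Complex.conj_I, ← Circle.coe_inv_eq_conj]
    at conj_he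
  refine ⟨![u, w], ![e, e⁻¹], ?_⟩
  simp only [Matrix.cons_val_zero, Matrix.cons_val_one, hu, w_mul_b]
  linear_combination he - conj_he

section Generation

variable {W : Type} [Fintype W] [DecidableEq W] {G : Subgroup (Matrix.unitaryGroup (W → Fin 2) ℂ)}

/-- The two Hadamard gates and the two diagonal operators let the amplitudes of each pair of basis
states that differ in the qubit `j` interfere destructively at `x j = 1`. -/
theorem exists_mulVec_eq_zero_of_eq_one (diagonal_mem : ∀ d, diagonalUnitary d ∈ G) {j : W}
    (gateH_mem : unitaryOnQubit j unitaryH ∈ G) (v : Ket W) :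
    ∃ g ∈ G, ∀ x, (x j = 1 → (g.1 *ᵥ v) x = 0) ∧
      (v (Function.update x j 0) = 0 → v (Function.update x j 1) = 0 → (g.1 *ᵥ v) x = 0) := by
  choose p d interference using exists_phases_mul_add_eq_mul_sub
  let amplitude (s : Fin 2) (x : W → Fin 2) : ℂ := v (Function.update x j s)
  let P := diagonalUnitary fun x => p (amplitude 0 x) (amplitude 1 x) (x j)
  let D := diagonalUnitary fun x => d (amplitude 0 x) (amplitude 1 x) (x j)
  let H := unitaryOnQubit j unitaryH
  have mulVec_apply (x : W → Fin 2) : ((H * D * H * P).1 *ᵥ v) x =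
      ∑ s, gateH (x j) s * (d (amplitude 0 x) (amplitude 1 x) s *
        ∑ t, gateH s t * (p (amplitude 0 x) (amplitude 1 x) t * amplitude t x)) := by
    change ((onQubit j gateH * Matrix.diagonal _ * onQubit j gateH * Matrix.diagonal _) *ᵥ v) x = _
    simp only [← Matrix.mulVec_mulVec, onQubit_mulVec, Matrix.mulVec_diagonal,
      Function.update_self, Function.update_idem, amplitude]
  refine ⟨H * D * H * P, mul_mem (mul_mem (mul_mem gateH_mem (diagonal_mem _)) gateH_mem)
    (diagonal_mem _), fun x => ⟨fun hx => ?_, fun h_zero h_one => ?_⟩⟩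
  · rw [mulVec_apply, hx]
    simp only [Fin.sum_univ_two, gateH, Matrix.smul_apply, smul_eq_mul, Matrix.of_apply,
      Matrix.cons_val_zero, Matrix.cons_val_one, mul_one]
    linear_combination ((Real.sqrt 2 : ℝ) : ℂ)⁻¹ * ((Real.sqrt 2 : ℝ) : ℂ)⁻¹ *
      interference (amplitude 0 x) (amplitude 1 x)
  · rw [mulVec_apply]
    simp [amplitude, h_zero, h_one]

theorem exists_mulVec_eq_single (diagonal_mem : ∀ d, diagonalUnitary d ∈ G)
    (gateH_mem : ∀ j, unitaryOnQubit j unitaryH ∈ G) (v : Ket W) :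
    ∃ g ∈ G, ∃ k c, g.1 *ᵥ v = Pi.single k c := by
  have supported_off (S : Finset W) :
      ∃ g ∈ G, ∀ x : W → Fin 2, (∃ i ∈ S, x i = 1) → (g.1 *ᵥ v) x = 0 := by
    induction S using Finset.induction_on with
    | empty => exact ⟨1, one_mem G, by simp⟩
    | insert j S hj ih =>
      obtain ⟨g, hg, g_support⟩ := ih
      obtain ⟨g', hg', g'_mulVec⟩ :=
        exists_mulVec_eq_zero_of_eq_one diagonal_mem (gateH_mem j) (g.1 *ᵥ v)
      refine ⟨g' * g, mul_mem hg' hg, fun x ⟨i, hi, hxi⟩ => ?_⟩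
      rw [MulMemClass.coe_mul, ← Matrix.mulVec_mulVec]
      rcases eq_or_ne i j with rfl | hij
      · exact (g'_mulVec x).1 hxi
      · have hiS : i ∈ S := (Finset.mem_insert.1 hi).resolve_left hij
        refine (g'_mulVec x).2 ?_ ?_ <;>
          exact g_support _ ⟨i, hiS, by rwa [Function.update_of_ne hij]⟩
  obtain ⟨g, hg, g_support⟩ := supported_off Finset.univ
  refine ⟨g, hg, 0, (g.1 *ᵥ v) 0, funext fun x => ?_⟩
  rcases eq_or_ne x 0 with rfl | hx
  · rw [Pi.single_eq_same]
  · obtain ⟨i, hi⟩ := Function.ne_iff.1 hx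
    rw [Pi.single_eq_of_ne hx]
    exact g_support x ⟨i, Finset.mem_univ i, Fin.eq_one_of_ne_zero _ hi⟩

theorem eq_top_of_gates_mem (phase_mem : ∀ c : Circle, diagonalUnitary (fun _ => c) ∈ G)
    (onQubit_mem : ∀ i d, unitaryOnQubit i (diagonalUnitary d) ∈ G)
    (gateH_mem : ∀ i, unitaryOnQubit i unitaryH ∈ G)
    (cnot_mem : ∀ (i j : W) (hij : i ≠ j), cnotUnitary hij ∈ G) : G = ⊤ := by
  have diagonal_mem := diagonalUnitary_mem phase_mem onQubit_mem cnot_mem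
  exact eq_top_of_isReflection_mem fun _ =>
    mem_of_isReflection diagonal_mem (exists_mulVec_eq_single diagonal_mem gateH_mem)

end Generation

/-- The group of the unitary operators that are programmable together with their inverses. -/
def programmableGroup (O : Family) (n : ℕ) : Subgroup (Matrix.unitaryGroup (Fin n → Fin 2) ℂ) where
  carrier := {U | Programmable O U.1 ∧ Programmable O U⁻¹.1}
  one_mem' := ⟨Programmable.one O, by rw [inv_one]; exact Programmable.one O⟩
  mul_mem' {U V} hU hV := ⟨hU.1.mul hV.1, by rw [mul_inv_rev]; exact hV.2.mul hU.2⟩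
  inv_mem' {U} hU := ⟨hU.2, by rw [inv_inv]; exact hU.1⟩

theorem phase_mem_programmableGroup (O : Family) (n : ℕ) (c : Circle) :
    diagonalUnitary (fun _ => c) ∈ programmableGroup O n := by
  have programmable_phase (z : Circle) :
      Programmable O (diagonalUnitary fun _ : Fin n → Fin 2 => z).1 := by
    change Programmable O (Matrix.diagonal fun _ => (z : ℂ))
    rw [← Matrix.smul_one_eq_diagonal]
    exact (Programmable.one O).smul z.coe_ne_zero
  refine ⟨programmable_phase c, ?_⟩
  rw [← map_inv]
  exact programmable_phase c⁻¹

theorem unitaryOnQubit_mem_programmableGroup {O : Family} {n : ℕ} {i : Fin n}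
    {U : Matrix.unitaryGroup (Fin 2) ℂ} (hU : Programmable O (onQubit i U.1))
    (hU_inv : Programmable O (onQubit i U⁻¹.1)) :
    unitaryOnQubit i U ∈ programmableGroup O n :=
  ⟨hU, by rw [← map_inv]; exact hU_inv⟩

theorem unitaryH_inv : unitaryH⁻¹ = unitaryH :=
  inv_eq_of_mul_eq_one_left (Subtype.ext isObservable_gateH.mul_self)

theorem cnotUnitary_inv {W : Type} [Fintype W] [DecidableEq W] {a b : W} (hab : a ≠ b) :
    (cnotUnitary hab)⁻¹ = cnotUnitary hab :=
  inv_eq_of_mul_eq_one_left (Subtype.ext (cnotOp_mul_self hab))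

theorem cnotUnitary_mem_programmableGroup {O : Family} {n : ℕ} {i j : Fin n} {hij : i ≠ j}
    (h : Programmable O (cnotOp hij)) : cnotUnitary hij ∈ programmableGroup O n :=
  ⟨h, by rw [cnotUnitary_inv]; exact h⟩

theorem exactlyUniversal_allObs : ExactlyUniversal allObs := by
  intro n U hU
  have programmableGroup_eq_top : programmableGroup allObs n = ⊤ :=
    eq_top_of_gates_mem (phase_mem_programmableGroup allObs n)
      (fun i d => unitaryOnQubit_mem_programmableGroup (programmable_onQubit_allObs i _)
        (programmable_onQubit_allObs i _))
      (fun i => unitaryOnQubit_mem_programmableGroup (programmable_onQubit_allObs i _)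
        (programmable_onQubit_allObs i _))
      fun i j hij => cnotUnitary_mem_programmableGroup <|
        (programmable_cnotOp hij).mono (Set.subset_univ _) (Set.subset_univ _)
  have mem_programmableGroup : ⟨U, hU⟩ ∈ programmableGroup allObs n :=
    programmableGroup_eq_top ▸ Subgroup.mem_top _
  exact mem_programmableGroup.1.simulable

/-! ### Rotations about observables -/

theorem denseRange_zpow_of_not_isOfFinOrder {z : Circle} (hz : ¬IsOfFinOrder z) :
    DenseRange fun k : ℤ => z ^ k := by
  have : Fact ((0 : ℝ) < 1) := ⟨one_pos⟩
  let toCircle := AddCircle.homeomorphCircle (T := 1) one_ne_zero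
  obtain ⟨a, rfl⟩ := toCircle.surjective z
  have addOrderOf_eq_zero : addOrderOf a = 0 := by
    refine addOrderOf_eq_zero_iff.2 fun ha => hz ?_
    obtain ⟨k, hk, nsmul_eq_zero⟩ := isOfFinAddOrder_iff_nsmul_eq_zero.1 ha
    refine isOfFinOrder_iff_pow_eq_one.2 ⟨k, hk, ?_⟩
    rw [AddCircle.homeomorphCircle_apply, ← AddCircle.toCircle_nsmul, nsmul_eq_zero,
      AddCircle.toCircle_zero]
  have denseRange_zsmul := AddCircle.denseRange_zsmul_iff.2 addOrderOf_eq_zero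
  convert toCircle.surjective.denseRange.comp denseRange_zsmul toCircle.continuous using 1
  funext k
  simp [toCircle, AddCircle.homeomorphCircle_apply, AddCircle.toCircle_zsmul]

theorem re_mul_re_add_im_mul_im (z : Circle) :
    ((z : ℂ).re : ℂ) * (z : ℂ).re + (z : ℂ).im * (z : ℂ).im = 1 := by
  exact_mod_cast (Complex.normSq_apply _).symm.trans (Circle.normSq_coe z)

theorem re_eq_im_of_sq_eq_I {z : Circle} (hz : (z : ℂ) ^ 2 = Complex.I) :
    (z : ℂ).re = (z : ℂ).im := by
  have normSq_eq : (z : ℂ).re * (z : ℂ).re + (z : ℂ).im * (z : ℂ).im = 1 :=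
    (Complex.normSq_apply _).symm.trans (Circle.normSq_coe z)
  have im_sq : (z : ℂ).re * (z : ℂ).im + (z : ℂ).im * (z : ℂ).re = 1 := by
    rw [← Complex.mul_im, ← pow_two, hz, Complex.I_im]
  nlinarith [sq_nonneg ((z : ℂ).re - (z : ℂ).im)]

section Rotations

variable {A : Type*} [Ring A] [StarRing A] [Algebra ℂ A] {O O' : A}

theorem IsObservable.smul_one_add_smul_mul (hO : IsObservable O) (a b c d : ℂ) :
    (a • 1 + b • O) * (c • 1 + d • O) = (a * c + b * d) • 1 + (a * d + b * c) • O := by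
  simp only [add_mul, mul_add, smul_mul_smul_comm, one_mul, mul_one, hO.mul_self]
  module

variable [StarModule ℂ A]

theorem IsObservable.re_smul_one_add_im_smul_mem_unitary (hO : IsObservable O) (z : Circle) :
    ((z : ℂ).re : ℂ) • 1 + ((z : ℂ).im * Complex.I) • O ∈ unitary A := by
  have star_eq : star (((z : ℂ).re : ℂ) • 1 + ((z : ℂ).im * Complex.I) • O) =
      ((z : ℂ).re : ℂ) • 1 + (-((z : ℂ).im * Complex.I)) • O := by
    simp [star_smul, hO.isSelfAdjoint.star_eq, Complex.conj_ofReal]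
  rw [Unitary.mem_iff, star_eq, hO.smul_one_add_smul_mul, hO.smul_one_add_smul_mul]
  constructor <;>
  · match_scalars
    · linear_combination re_mul_re_add_im_mul_im z - (z : ℂ).im * (z : ℂ).im * Complex.I_mul_I
    · ring

/-- The rotations about an observable `O`, which are the operators `e^{iθO}`, as a homomorphism from
the circle. -/
def IsObservable.rotation (hO : IsObservable O) : Circle →* unitary A where
  toFun z := ⟨((z : ℂ).re : ℂ) • 1 + ((z : ℂ).im * Complex.I) • O,
    hO.re_smul_one_add_im_smul_mem_unitary z⟩
  map_one' := Subtype.ext (by simp)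
  map_mul' z w := by
    refine Subtype.ext (Eq.trans ?_ (hO.smul_one_add_smul_mul _ _ _ _).symm)
    simp only [Circle.coe_mul, Complex.mul_re, Complex.mul_im, Complex.ofReal_sub,
      Complex.ofReal_add, Complex.ofReal_mul]
    match_scalars
    · linear_combination -((z : ℂ).im * (w : ℂ).im) * Complex.I_mul_I
    · ring

theorem IsObservable.coe_rotation (hO : IsObservable O) (z : Circle) :
    (hO.rotation z : A) = ((z : ℂ).re : ℂ) • 1 + ((z : ℂ).im * Complex.I) • O := rfl

theorem IsObservable.mul_rotation_mul_inv (hO : IsObservable O) (hO' : IsObservable O')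
    {U : unitary A} (hU : U * O = O' * U) (z : Circle) :
    U * hO.rotation z * U⁻¹ = hO'.rotation z := by
  refine mul_inv_eq_of_eq_mul (Subtype.ext ?_)
  simp only [MulMemClass.coe_mul, IsObservable.coe_rotation, mul_add, add_mul, mul_smul_comm,
    smul_mul_assoc, mul_one, one_mul, hU]

theorem IsObservable.I_smul_mul (hO : IsObservable O) (hO' : IsObservable O')
    (anticommute : Anticommute O O') : IsObservable (Complex.I • (O * O')) where
  isSelfAdjoint := by
    rw [IsSelfAdjoint, star_smul, star_mul, hO.isSelfAdjoint.star_eq, hO'.isSelfAdjoint.star_eq,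
      anticommute, Complex.star_def, Complex.conj_I, neg_smul, smul_neg]
  mul_self := by
    have mul_mul_mul : O * O' * (O * O') = -1 := calc
      O * O' * (O * O') = O * (O' * O) * O' := by simp only [mul_assoc]
      _ = -(O * O * (O' * O')) := by
        rw [← neg_eq_iff_eq_neg.2 anticommute, mul_neg, neg_mul]
        simp only [mul_assoc]
      _ = -1 := by rw [hO.mul_self, hO'.mul_self, one_mul]
    rw [smul_mul_smul_comm, Complex.I_mul_I, mul_mul_mul, neg_one_smul, neg_neg]

theorem IsObservable.rotation_mul_rotation_mul_inv (hO : IsObservable O) (hO' : IsObservable O')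
    (anticommute : Anticommute O O') {ζ : Circle} (hζ : (ζ : ℂ) ^ 2 = Complex.I) (z : Circle) :
    hO.rotation ζ * hO'.rotation z * (hO.rotation ζ)⁻¹ =
      (hO.I_smul_mul hO' anticommute).rotation z := by
  refine hO'.mul_rotation_mul_inv _ ?_ z
  have mul_mul_self : O * O' * O = -O' := by
    rw [anticommute, neg_mul, mul_assoc, hO.mul_self, mul_one]
  simp only [hO.coe_rotation, re_eq_im_of_sq_eq_I hζ, add_mul, mul_add, smul_mul_assoc,
    mul_smul_comm, one_mul, mul_one, mul_mul_self]
  match_scalars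
  · linear_combination ((ζ : ℂ).im : ℂ) * Complex.I_mul_I
  · ring

variable [TopologicalSpace A] [ContinuousAdd A] [ContinuousSMul ℂ A]

theorem IsObservable.continuous_rotation (hO : IsObservable O) : Continuous hO.rotation := by
  refine Continuous.subtype_mk ?_ _
  fun_prop

theorem IsObservable.rotation_mem (hO : IsObservable O) {G : Subgroup (unitary A)}
    (hG : IsClosed (G : Set (unitary A))) {z : Circle} (hz : ¬IsOfFinOrder z)
    (rotation_mem : hO.rotation z ∈ G) (w : Circle) : hO.rotation w ∈ G := by
  have zpow_mem (k : ℤ) : z ^ k ∈ hO.rotation ⁻¹' G := by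
    rw [Set.mem_preimage, map_zpow]
    exact G.zpow_mem rotation_mem k
  exact (hG.preimage hO.continuous_rotation).closure_subset_iff.2
    (Set.range_subset_iff.2 zpow_mem) (denseRange_zpow_of_not_isOfFinOrder hz w)

end Rotations

/-- For a root of unity `z` the number `z + z⁻¹ - 1` would be an algebraic integer, but here it is
`√2 / 2`, whose square is `1 / 2`. -/
theorem not_isOfFinOrder_of_re_eq {z : Circle} (hre : (z : ℂ).re = (2 + Real.sqrt 2) / 4) :
    ¬IsOfFinOrder z := by
  intro hz
  obtain ⟨k, hk, z_pow⟩ := isOfFinOrder_iff_pow_eq_one.1 hz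
  have coe_z_pow : (z : ℂ) ^ k = 1 := by rw [← Circle.coe_pow, z_pow, Circle.coe_one]
  have isIntegral_of_pow {w : ℂ} (hw : w ^ k = 1) : IsIntegral ℤ w :=
    IsIntegral.of_pow hk (hw ▸ isIntegral_one)
  have trace_eq : (z : ℂ) + star (z : ℂ) - 1 = ((Real.sqrt 2 / 2 : ℝ) : ℂ) := by
    rw [Complex.star_def, Complex.add_conj, hre]
    push_cast
    ring
  have isIntegral_trace : IsIntegral ℤ ((z : ℂ) + star (z : ℂ) - 1) :=
    ((isIntegral_of_pow coe_z_pow).add <| isIntegral_of_pow <| by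
      rw [← star_pow, coe_z_pow, star_one]).sub isIntegral_one
  have trace_sq : ((z : ℂ) + star (z : ℂ) - 1) ^ 2 = algebraMap ℚ ℂ (1 / 2) := by
    rw [trace_eq, ← Complex.ofReal_pow, div_pow, Real.sq_sqrt (by norm_num)]
    norm_num
  have isIntegral_half : IsIntegral ℤ (1 / 2 : ℚ) := by
    rw [← isIntegral_algebraMap_iff (algebraMap ℚ ℂ).injective, ← trace_sq]
    exact isIntegral_trace.pow 2
  obtain ⟨m, hm⟩ := IsIntegrallyClosed.isIntegral_iff.1 isIntegral_half
  have two_mul_m : (2 : ℚ) * m = 1 := by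
    rw [← eq_intCast (algebraMap ℤ ℚ), hm]
    norm_num
  norm_cast at two_mul_m
  omega

/-! ### Closed groups generated by `H` and `T` -/

/-- The observable `cos θ X + sin θ Y`, where `o = e^{iθ}`. -/
def equatorial (o : Circle) : Mat1 := !![0, (o⁻¹ : Circle); (o : ℂ), 0]

theorem isObservable_equatorial (o : Circle) : IsObservable (equatorial o) where
  isSelfAdjoint := by
    ext i j
    fin_cases i <;> fin_cases j <;> simp [equatorial, ← Circle.coe_inv_eq_conj]
  mul_self := by
    ext i j
    fin_cases i <;> fin_cases j <;> simp [equatorial]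

theorem coe_zeta8_sq_mul (o : Circle) : ((zeta8 ^ 2 * o : Circle) : ℂ) = Complex.I * o := by
  rw [Circle.coe_mul, Circle.coe_pow, zeta8_sq]

theorem equatorial_zeta8_sq_mul (o : Circle) :
    equatorial (zeta8 ^ 2 * o) =
      !![0, -(Complex.I * (o⁻¹ : Circle)); Complex.I * o, 0] := by
  rw [equatorial, Circle.coe_inv, coe_zeta8_sq_mul, mul_inv, Complex.inv_I, neg_mul, Circle.coe_inv]

theorem anticommute_equatorial (o : Circle) :
    Anticommute (equatorial o) (equatorial (zeta8 ^ 2 * o)) := by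
  rw [Anticommute, equatorial_zeta8_sq_mul, equatorial]
  ext i j
  fin_cases i <;> fin_cases j <;> simp [mul_left_comm _ Complex.I]

theorem unitaryT_sq_mul_equatorial (o : Circle) :
    ((unitaryT ^ 2 : Matrix.unitaryGroup (Fin 2) ℂ) : Mat1) * equatorial o =
      equatorial (zeta8 ^ 2 * o) * (unitaryT ^ 2 : Matrix.unitaryGroup (Fin 2) ℂ) := by
  have coe_sq : ((unitaryT ^ 2 : Matrix.unitaryGroup (Fin 2) ℂ) : Mat1) =
      !![1, 0; 0, Complex.I] := by
    rw [SubmonoidClass.coe_pow, coe_unitaryT, gateT_eq, Matrix.diagonal_pow,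
      Matrix.diagonal_fin_two]
    simp [zeta8_sq]
  rw [coe_sq, equatorial_zeta8_sq_mul, equatorial]
  ext i j
  fin_cases i <;> fin_cases j <;> simp [mul_right_comm Complex.I, Complex.I_mul_I]

theorem rotation_I_smul_equatorial_mul (o w : Circle) :
    ((isObservable_equatorial o).I_smul_mul (isObservable_equatorial _)
      (anticommute_equatorial o)).rotation w = diagonalUnitary ![w⁻¹, w] := by
  have I_smul_mul_eq : Complex.I • (equatorial o * equatorial (zeta8 ^ 2 * o)) =
      Matrix.diagonal ![-1, 1] := by
    rw [equatorial_zeta8_sq_mul, equatorial]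
    ext i j
    fin_cases i <;> fin_cases j <;> simp [mul_left_comm _ Complex.I]
  refine Subtype.ext ?_
  rw [IsObservable.coe_rotation, I_smul_mul_eq]
  change _ = Matrix.diagonal _
  ext i j
  fin_cases i <;> fin_cases j <;>
    simp [-Circle.coe_inv, Circle.coe_inv_eq_conj, Complex.ext_iff]

theorem exists_rotation_equatorial_eq {a : ℝ} {b : ℂ} (hab : a ^ 2 + ‖b‖ ^ 2 = 1) :
    ∃ z o : Circle, (z : ℂ).re = a ∧
      ((isObservable_equatorial o).rotation z : Mat1) = !![(a : ℂ), -star b; b, a] := by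
  obtain ⟨c, c_mul_b⟩ := exists_circle_mul_eq_norm b
  have b_eq : b = (c⁻¹ : Circle) * ‖b‖ := by
    rw [Circle.coe_inv, ← c_mul_b, inv_mul_cancel_left₀ c.coe_ne_zero]
  have star_b_eq : star b = c * ‖b‖ := by
    have star_mul_star : star (c : ℂ) * star b = ‖b‖ := by
      rw [← star_mul', c_mul_b, Complex.star_def, Complex.conj_ofReal]
    rw [← star_mul_star, Complex.star_def, ← Circle.coe_inv_eq_conj, Circle.coe_inv,
      mul_inv_cancel_left₀ c.coe_ne_zero]
  obtain ⟨z, z_re, z_im⟩ : ∃ z : Circle, (z : ℂ).re = a ∧ (z : ℂ).im = ‖b‖ := by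
    refine ⟨⟨⟨a, ‖b‖⟩, mem_sphere_zero_iff_norm.2 ?_⟩, rfl, rfl⟩
    rw [← pow_eq_one_iff_of_nonneg (norm_nonneg _) two_ne_zero, ← Complex.normSq_eq_norm_sq,
      Complex.normSq_mk, ← hab]
    ring
  refine ⟨z, (zeta8 ^ 2 * c)⁻¹, z_re, ?_⟩
  rw [IsObservable.coe_rotation, equatorial, inv_inv, Circle.coe_inv, coe_zeta8_sq_mul,
    star_b_eq, z_re, z_im]
  have entry_zero_one : ‖b‖ * Complex.I * (Complex.I * c) = -(c * ‖b‖) := by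
    linear_combination ‖b‖ * c * Complex.I_mul_I
  have entry_one_zero : -(‖b‖ * Complex.I * ((c : ℂ)⁻¹ * Complex.I)) = b := by
    rw [Circle.coe_inv] at b_eq
    linear_combination -(‖b‖ * (c : ℂ)⁻¹) * Complex.I_mul_I - b_eq
  ext i j
  fin_cases i <;> fin_cases j <;> simp [entry_zero_one, entry_one_zero]

theorem gateH_mul_diagonal_mul_gateH (w : ℂ) : gateH * Matrix.diagonal ![1, w] * gateH =
    (2 : ℂ)⁻¹ • !![1 + w, 1 - w; 1 - w, 1 + w] := by
  rw [gateH, smul_mul_assoc, smul_mul_smul_comm, invSqrtTwo_mul_self, Matrix.diagonal_fin_two]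
  ext i j
  fin_cases i <;> fin_cases j <;> simp [sub_eq_add_neg]

theorem gate_word_eq :
    (gateH * gateT * gateH) * gateTᴴ * ((gateH * gateT * gateH) * gateT) *
        (gateT * (gateH * gateTᴴ * gateH)) =
      (zeta8 : ℂ) • !![(((2 + Real.sqrt 2) / 4 : ℝ) : ℂ),
          -star (-1 / 2 - ((2 - Real.sqrt 2) / 4 : ℝ) * Complex.I);
        -1 / 2 - ((2 - Real.sqrt 2) / 4 : ℝ) * Complex.I, (((2 + Real.sqrt 2) / 4 : ℝ) : ℂ)] := by
  have conjTranspose_eq : gateTᴴ = Matrix.diagonal ![1, star (zeta8 : ℂ)] := by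
    rw [gateT_eq, Matrix.diagonal_fin_two, Matrix.diagonal_fin_two]
    ext i j
    fin_cases i <;> fin_cases j <;> simp
  have star_entry (q : ℝ) : star (-1 / 2 - q * Complex.I) = -1 / 2 + q * Complex.I := by
    simp [Complex.conj_ofReal]
  have sqrt_mul_sqrt : ((Real.sqrt 2 : ℝ) : ℂ) * (Real.sqrt 2 : ℝ) = 2 := by
    rw [← Complex.ofReal_mul, Real.mul_self_sqrt (by norm_num), Complex.ofReal_ofNat]
  have inv_sqrt_eq : ((Real.sqrt 2 : ℝ) : ℂ)⁻¹ = (Real.sqrt 2 : ℝ) / 2 := by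
    rw [inv_eq_iff_eq_inv, inv_div, ← sqrt_mul_sqrt, mul_self_div_self]
  have I_mul_I := Complex.I_mul_I
  rw [star_entry, conjTranspose_eq, gateT_eq, gateH_mul_diagonal_mul_gateH,
    gateH_mul_diagonal_mul_gateH, Matrix.diagonal_fin_two, Matrix.diagonal_fin_two, star_zeta8,
    coe_zeta8, inv_sqrt_eq]
  push_cast
  clear star_entry conjTranspose_eq inv_sqrt_eq
  generalize ((Real.sqrt 2 : ℝ) : ℂ) = s at sqrt_mul_sqrt ⊢
  generalize Complex.I = i at I_mul_I ⊢
  ext j k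
  fin_cases j <;> fin_cases k <;> simp <;> grind

theorem exists_rotation_equatorial_mem {G : Subgroup (Matrix.unitaryGroup (Fin 2) ℂ)}
    (phase_mem : ∀ c : Circle, diagonalUnitary (fun _ => c) ∈ G) (H_mem : unitaryH ∈ G)
    (T_mem : unitaryT ∈ G) :
    ∃ z o : Circle, ¬IsOfFinOrder z ∧ (isObservable_equatorial o).rotation z ∈ G := by
  have sq_sqrt_two : Real.sqrt 2 ^ 2 = 2 := Real.sq_sqrt (by norm_num)
  obtain ⟨z, o, z_re, rotation_eq⟩ := exists_rotation_equatorial_eq (a := (2 + Real.sqrt 2) / 4)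
    (b := -1 / 2 - ((2 - Real.sqrt 2) / 4 : ℝ) * Complex.I) <| by
      have entry_eq : -1 / 2 - ((2 - Real.sqrt 2) / 4 : ℝ) * Complex.I =
          ((-1 / 2 : ℝ) : ℂ) + ((-(2 - Real.sqrt 2) / 4 : ℝ) : ℂ) * Complex.I := by
        push_cast
        ring
      rw [← Complex.normSq_eq_norm_sq, entry_eq, Complex.normSq_add_mul_I]
      linear_combination sq_sqrt_two / 8
  refine ⟨z, o, not_isOfFinOrder_of_re_eq z_re, ?_⟩
  let A := unitaryH * unitaryT * unitaryH
  have phase_mul_rotation : diagonalUnitary (fun _ => zeta8) *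
      (isObservable_equatorial o).rotation z =
        A * unitaryT⁻¹ * (A * unitaryT) * (unitaryT * (unitaryH * unitaryT⁻¹ * unitaryH)) := by
    refine Subtype.ext (Eq.trans ?_ (gate_word_eq.symm.trans ?_))
    · rw [Matrix.UnitaryGroup.mul_val, rotation_eq, Matrix.smul_eq_diagonal_mul]
      rfl
    · rw [← coe_unitaryT]
      rfl
  have A_mem : A ∈ G := mul_mem (mul_mem H_mem T_mem) H_mem
  refine (G.mul_mem_cancel_left (phase_mem zeta8)).1 ?_
  rw [phase_mul_rotation]
  exact mul_mem (mul_mem (mul_mem A_mem (inv_mem T_mem)) (mul_mem A_mem T_mem))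
    (mul_mem T_mem (mul_mem (mul_mem H_mem (inv_mem T_mem)) H_mem))

/-- The gate `T²` turns the axis of a rotation in the equator by a right angle; the rotations about
these two axes generate the rotations about the `Z` axis. -/
theorem diagonalUnitary_mem_of_unitaryH_mem_of_unitaryT_mem
    {G : Subgroup (Matrix.unitaryGroup (Fin 2) ℂ)}
    (hG : IsClosed (G : Set (Matrix.unitaryGroup (Fin 2) ℂ)))
    (phase_mem : ∀ c : Circle, diagonalUnitary (fun _ => c) ∈ G) (H_mem : unitaryH ∈ G)
    (T_mem : unitaryT ∈ G) (d : Fin 2 → Circle) : diagonalUnitary d ∈ G := by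
  obtain ⟨z, o, hz, rotation_z_mem⟩ := exists_rotation_equatorial_mem phase_mem H_mem T_mem
  have hO := isObservable_equatorial o
  have hO' := isObservable_equatorial (zeta8 ^ 2 * o)
  have rotation_mem (w : Circle) : hO.rotation w ∈ G := hO.rotation_mem hG hz rotation_z_mem w
  have rotation_mem' (w : Circle) : hO'.rotation w ∈ G := by
    rw [← hO.mul_rotation_mul_inv hO' (unitaryT_sq_mul_equatorial o)]
    exact mul_mem (mul_mem (pow_mem T_mem 2) (rotation_mem w)) (inv_mem (pow_mem T_mem 2))
  have diagonal_mem (w : Circle) : diagonalUnitary ![w⁻¹, w] ∈ G := by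
    rw [← rotation_I_smul_equatorial_mul o,
      ← hO.rotation_mul_rotation_mul_inv hO' (anticommute_equatorial o) zeta8_sq]
    exact mul_mem (mul_mem (rotation_mem _) (rotation_mem' w)) (inv_mem (rotation_mem _))
  obtain ⟨c, c_mul_c⟩ : ∃ c : Circle, c * c = d 0 * d 1 := by
    refine ⟨Circle.exp (Complex.arg (d 0 * d 1 : Circle) / 2), ?_⟩
    rw [← Circle.exp_add, add_halves, Circle.exp_arg]
  have d_eq : d = (fun _ => c) * ![(c⁻¹ * d 1)⁻¹, c⁻¹ * d 1] := by
    funext k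
    fin_cases k
    · simp [mul_left_comm c, c_mul_c]
    · simp
  rw [d_eq, map_mul]
  exact mul_mem (phase_mem c) (diagonal_mem _)

/-! ### Universality -/

theorem continuous_unitaryOnQubit {W : Type} [Fintype W] [DecidableEq W] (a : W) :
    Continuous (unitaryOnQubit a) :=
  ((continuous_onQubit a).comp continuous_subtype_val).subtype_mk _

theorem topologicalClosure_programmableGroup_obsFamily₂ (n : ℕ) :
    (programmableGroup obsFamily₂ n).topologicalClosure = ⊤ := by
  let G := programmableGroup obsFamily₂ n
  have le_closure : G ≤ G.topologicalClosure := G.le_topologicalClosure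
  have phase_mem (c : Circle) : diagonalUnitary (fun _ => c) ∈ G :=
    phase_mem_programmableGroup obsFamily₂ n c
  have gateH_mem (i : Fin n) : unitaryOnQubit i unitaryH ∈ G :=
    unitaryOnQubit_mem_programmableGroup (programmable_gateH i)
      (by rw [unitaryH_inv]; exact programmable_gateH i)
  have gateT_mem (i : Fin n) : unitaryOnQubit i unitaryT ∈ G :=
    unitaryOnQubit_mem_programmableGroup (by rw [coe_unitaryT]; exact programmable_gateT i)
      (programmable_inv_gateT i)
  refine eq_top_of_gates_mem (fun c => le_closure (phase_mem c)) (fun i => ?_)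
    (fun i => le_closure (gateH_mem i))
    fun i j hij => le_closure (cnotUnitary_mem_programmableGroup (programmable_cnotOp hij))
  exact diagonalUnitary_mem_of_unitaryH_mem_of_unitaryT_mem
    (G := G.topologicalClosure.comap (unitaryOnQubit i))
    (G.isClosed_topologicalClosure.preimage (continuous_unitaryOnQubit i))
    (fun c => le_closure (by rw [unitaryOnQubit_diagonalUnitary]; exact phase_mem c))
    (le_closure (gateH_mem i)) (le_closure (gateT_mem i))

open scoped Matrix.Norms.L2Operator in
theorem universal_of_obsFamily₂_subset {O : Family} (one_subset : obsFamily₂.one ⊆ O.one)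
    (two_subset : obsFamily₂.two ⊆ O.two) : Universal O := by
  intro n U hU ε hε
  have mem_closure : (⟨U, hU⟩ : Matrix.unitaryGroup (Fin n → Fin 2) ℂ) ∈
      closure (programmableGroup obsFamily₂ n : Set (Matrix.unitaryGroup (Fin n → Fin 2) ℂ)) := by
    rw [← Subgroup.topologicalClosure_coe, topologicalClosure_programmableGroup_obsFamily₂]
    exact Subgroup.mem_top _
  obtain ⟨V, hV, dist_lt⟩ := Metric.mem_closure_iff.1 mem_closure ε hε
  refine ⟨V, V.2, ?_, (hV.1.mono one_subset two_subset).simulable⟩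
  rwa [dist_comm, Subtype.dist_eq, dist_eq_norm] at dist_lt

theorem simulatesCircuits_of_obsFamily₂_subset {O : Family}
    (one_subset : obsFamily₂.one ⊆ O.one) (two_subset : obsFamily₂.two ⊆ O.two) :
    SimulatesCircuits O gatesHT ∧ SimulatesCircuits O gatesHHT :=
  ⟨fun _ c hc => ((programmable_gatesHT c hc).mono one_subset two_subset).simulable,
    fun _ c hc => ((programmable_gatesHHT c hc).mono one_subset two_subset).simulable⟩

end

end StateTransfer

theorem mainTheorem3 :
    StateTransfer.ExactlyUniversal StateTransfer.allObs ∧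
    (StateTransfer.SimulatesCircuits StateTransfer.obsFamily₁ StateTransfer.gatesHT ∧
      StateTransfer.SimulatesCircuits StateTransfer.obsFamily₁ StateTransfer.gatesHHT ∧
      StateTransfer.Universal StateTransfer.obsFamily₁) ∧
    (StateTransfer.SimulatesCircuits StateTransfer.obsFamily₂ StateTransfer.gatesHT ∧
      StateTransfer.SimulatesCircuits StateTransfer.obsFamily₂ StateTransfer.gatesHHT ∧
      StateTransfer.Universal StateTransfer.obsFamily₂) := by
  have circuits₁ := StateTransfer.simulatesCircuits_of_obsFamily₂_subset
    StateTransfer.obsFamily₂_one_subset StateTransfer.obsFamily₂_two_subset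
  have universal₁ := StateTransfer.universal_of_obsFamily₂_subset
    StateTransfer.obsFamily₂_one_subset StateTransfer.obsFamily₂_two_subset
  have circuits₂ := StateTransfer.simulatesCircuits_of_obsFamily₂_subset
    (O := StateTransfer.obsFamily₂) subset_rfl subset_rfl
  have universal₂ := StateTransfer.universal_of_obsFamily₂_subset
    (O := StateTransfer.obsFamily₂) subset_rfl subset_rfl
  exact ⟨StateTransfer.exactlyUniversal_allObs, ⟨circuits₁.1, circuits₁.2, universal₁⟩,
    circuits₂.1, circuits₂.2, universal₂⟩
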